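/- **Conventions.** For $z\in\mathbb C^*$ the scale is $s(z)=1+\lfloor\log_2|z|\rfloor$, and $s(0)=-\infty$. For $z,z'\in\mathbb C$ and $q\in[-\infty,\infty]$ write $z\approx_q z'$ if $s(z-z')\le\max\{s(z),s(z')\}-q-2$ (for $q=-\infty$ this always holds). A $p$-bit floating-point number is $0$ or a real number $\pm2^n\times0.1\xi_1\dots\xi_p$ in base $2$, with $n\in\mathbb Z$ and $\xi_i\in\{0,1\}$. For $a\in\mathbb C$, $\widetilde a$ denotes its $p$-bit representation: real and imaginary parts are rounded separately to the nearest $p$-bit number, ties away from zero. $[\![m,n]\!]$ is the set of integers in $[m,n]$. Let $P(z)=\sum_{j=0}^d a_jz^j\in\mathbb C[z]$ with $d=\deg P\ge1$ and $a_0\ne0$, and let $p\ge1$ be an integer. Let $\widehat E_P$ be the concave cover of $k\mapsto s(a_k)$, i.e. the least real concave function on $[0,d]$ with $s(a_k)\le\widehat E_P(k)$ for all $k\in[\![0,d]\!]$. Let $$G_p=\{k\in[\![0,d]\!]:\ s(a_k)\ge\widehat E_P(k)-p-s(d)-3\}.$$ For $z\ne0$ put $\lambda=\log_2|z|$, and let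 $\ell$ and $r$ be the least and the greatest $k\in[\![0,d]\!]$ with $$\widehat E_P(k)+\lambda k\ \ge\ \max_{x\in[0,d]}\big(\widehat E_P(x)+\lambda x\big)-p-s(d)-3 .$$ Let $$Q_\lambda(z)=\sum_{k\in G_p\cap[\![\ell,r]\!]}a_kz^k,\qquad \widetilde Q_\lambda(z)=\sum_{k\in G_p\cap[\![\ell,r]\!]}\widetilde{a_k}z^k .$$ Let $\mathcal M=\max_{0\le j\le d}|a_jz^j|$, and let $c$, the number of cancelled bits, be $0$ if $|P(z)|\ge\mathcal M$ and $s(\mathcal M)-s(P(z))$ otherwise ($c=+\infty$ if $P(z)=0$). **Theorem.** 1. (Correctness.) For every such $P$ and $p$ and every $z\in\mathbb C^*$, one has $c\ge0$ and $P(z)\approx_{p-c}Q_\lambda(z)$. If the coefficients $a_k$ with $k\in G_p\cap[\![\ell,r]\!]$ are given with $p$ bits (that is $\widetilde{a_k}=a_k$), then $P(z)\approx_{p-c}\widetilde Q_\lambda(z)$. Without any assumption on the coefficients, $P(z)\approx_{p-c-s(d)-2}\widetilde Q_\lambda(z)$. 2. (Average number of monomials, upper bound.) For every such $P$ and $p$,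 the average of $\#[\![\ell,r]\!]$ over $z$ uniformly distributed on the Riemann sphere, i.e. with respect to the probability measure $\dfrac{dx\,dy}{\pi(1+x^2+y^2)^2}$, $z=x+iy$, satisfies $$\operatorname{avg}_{\overline{\mathbb C}}\big(\#[\![\ell,r]\!]\big)<1+1.9046\,\sqrt{d\,(p+s(d)+3)} .$$ 3. (Lower bound.) For every integer $p\ge1$ there are polynomials $P_d$, $d\ge1$, with $\deg P_d=d$, $P_d(0)\neq0$ and $G_p=[\![0,d]\!]$, such that, for all sufficiently large $d$, $$\operatorname{avg}_{\overline{\mathbb C}}\big(\#[\![\ell,r]\!]\big)>1.3217\,\sqrt{d\,(p+s(d)+3)} .$$ -/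

import Mathlib

open Polynomial MeasureTheory

namespace FPE

noncomputable section

/-! ### Scales and finite precision -/

/-- The integer `1 + ⌊log₂ |z|⌋`, which is the scale of `z` when `z ≠ 0`. -/
def scaleInt (z : ℂ) : ℤ := 1 + ⌊Real.logb 2 ‖z‖⌋

/-- The scale `s(z)` of a complex number, with the convention `s(0) = -∞`. -/
def scale (z : ℂ) : EReal := if z = 0 then ⊥ else (((scaleInt z : ℤ) : ℝ) : EReal)

/-- `z ≈_q z'`, that is `s(z - z') ≤ max (s(z), s(z')) - q - 2`. The index `q` is allowed to be
any extended real number; for `q = -∞` the relation always holds. -/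
def Similar (q : EReal) (z z' : ℂ) : Prop :=
  scale (z - z') ≤ max (scale z) (scale z') - q - 2

/-- The unit in the last place `2 ^ (s(x) - p - 1)` at the scale of a real number `x ≠ 0`, for
floating-point numbers `± 2 ^ n × 0.1ξ₁…ξ_p`. -/
def ulp (p : ℕ) (x : ℝ) : ℝ := (2 : ℝ) ^ (scaleInt (x : ℂ) - (p : ℤ) - 1)

/-- The `p`-bit floating-point representation of a real number: the nearest number of the form
`± 2 ^ n × 0.1ξ₁…ξ_p` (or `0` for `x = 0`), ties being rounded away from zero. -/
def roundReal (p : ℕ) (x : ℝ) : ℝ :=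
  if x = 0 then 0 else SignType.sign x * ((⌊|x| / ulp p x + 1 / 2⌋ : ℤ) : ℝ) * ulp p x

/-- The `p`-bit floating-point representation of a complex number: the real and the imaginary
parts are rounded separately. -/
def roundComplex (p : ℕ) (z : ℂ) : ℂ := ⟨roundReal p z.re, roundReal p z.im⟩

/-! ### The algorithm. In what follows `d` is always the degree of `P`. -/

/-- The concave cover of `k ↦ s(a_k)`: the least real concave function on `[0, d]` that
dominates the scales of the coefficients, given as a pointwise infimum. -/
def concaveCover (P : ℂ[X]) (x : ℝ) : ℝ :=
  sInf {y : ℝ | ∃ g : ℝ → ℝ, ConcaveOn ℝ (Set.Icc 0 (P.natDegree : ℝ)) g ∧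
    (∀ k : ℕ, k ≤ P.natDegree → scale (P.coeff k) ≤ ((g k : ℝ) : EReal)) ∧ y = g x}

/-- The gap `p + s(d) + 3`. -/
def gap (P : ℂ[X]) (p : ℕ) : ℝ := (p : ℝ) + (scaleInt (P.natDegree : ℂ) : ℝ) + 3

/-- The set `G_p` of good indices, `s(a_k) ≥ Ê(k) - p - s(d) - 3`. -/
def goodIndices (P : ℂ[X]) (p : ℕ) : Finset ℕ :=
  (Finset.range (P.natDegree + 1)).filter fun k =>
    ((concaveCover P k - gap P p : ℝ) : EReal) ≤ scale (P.coeff k)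

/-- The maximum over `[0, d]` of the concave function `x ↦ Ê(x) + lam * x`. -/
def maxCover (P : ℂ[X]) (lam : ℝ) : ℝ :=
  sSup ((fun x : ℝ => concaveCover P x + lam * x) '' Set.Icc 0 (P.natDegree : ℝ))

/-- The indices `k` in `{0, …, d}` such that `Ê(k) + lam * k` is at least its maximum minus the
gap; by concavity this is a (non-empty) interval of integers. -/
def levelSet (P : ℂ[X]) (p : ℕ) (lam : ℝ) : Set ℕ :=
  {k : ℕ | k ≤ P.natDegree ∧ maxCover P lam - gap P p ≤ concaveCover P k + lam * k}

/-- The interval of integers `⟦ℓ, r⟧`, whose endpoints are the least and the greatest element of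
the level set. -/
def window (P : ℂ[X]) (p : ℕ) (lam : ℝ) : Finset ℕ :=
  Finset.Icc (sInf (levelSet P p lam)) (sSup (levelSet P p lam))

/-- The indices of the monomials that the algorithm keeps, `G_p ∩ ⟦ℓ, r⟧`. -/
def keptIndices (P : ℂ[X]) (p : ℕ) (lam : ℝ) : Finset ℕ :=
  goodIndices P p ∩ window P p lam

/-- The subexpression of `P` formed by the kept monomials, with the coefficients of `P`. -/
def subexpression (P : ℂ[X]) (p : ℕ) (lam : ℝ) : ℂ[X] :=
  ∑ k ∈ keptIndices P p lam, monomial k (P.coeff k)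

/-- The kept monomials, with coefficients rounded to `p` bits. -/
def roundedSubexpression (P : ℂ[X]) (p : ℕ) (lam : ℝ) : ℂ[X] :=
  ∑ k ∈ keptIndices P p lam, monomial k (roundComplex p (P.coeff k))

/-! ### Cancelled bits -/

/-- The largest modulus of a monomial, `max_j |a_j z ^ j|` for `0 ≤ j ≤ d`. -/
def maxMonomial (P : ℂ[X]) (z : ℂ) : ℝ :=
  (Finset.range (P.natDegree + 1)).sup' Finset.nonempty_range_add_one
    fun j => ‖P.coeff j * z ^ j‖

/-- The number `c` of cancelled bits; it is `+∞` when `P(z) = 0` (and `P`, `z` are not). -/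
def cancelledBits (P : ℂ[X]) (z : ℂ) : EReal :=
  if maxMonomial P z ≤ ‖P.eval z‖ then 0
  else scale (maxMonomial P z : ℂ) - scale (P.eval z)

/-! ### Averages on the Riemann sphere -/

/-- The uniform probability measure of the Riemann sphere in the coordinate `z = x + i y`, with
volume element `dx dy / (π (1 + x² + y²)²)`. -/
def sphereMeasure : Measure ℂ :=
  volume.withDensity fun z => ENNReal.ofReal (1 / (Real.pi * (1 + ‖z‖ ^ 2) ^ 2))

/-- The cardinality of `⟦ℓ, r⟧` for the evaluation point `z`, where `lam = log₂ |z|`. -/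
def windowCard (P : ℂ[X]) (p : ℕ) (z : ℂ) : ℝ := ((window P p (Real.logb 2 ‖z‖)).card : ℝ)

/-- The average of the cardinality of `⟦ℓ, r⟧` over the Riemann sphere. -/
def avgWindowCard (P : ℂ[X]) (p : ℕ) : ℝ := ∫ z, windowCard P p z ∂sphereMeasure

end

end FPE

/-!
**Correctness.** Write `λ = log₂ |z|`, `s_k` for the scale of the `k`-th coefficient, `Ê` for the
concave cover and `g = p + s(d) + 3` for the gap. For the index `k` that maximises `s_k + λ k`, the
affine function `x ↦ s_k + λ k - λ x` is a concave majorant of the scales, so `Ê(x) + λ x` has the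
maximum `s_k + λ k` and `k` is kept (`exists_dominant_index`). Every discarded monomial is smaller
than the largest one by the factor `2 ^ (1 - g)`, and there are at most `d < 2 ^ s(d)` of them
(`norm_eval_sub_subexpression_le`). Rounding adds a relative error of at most `3 * 2 ^ (-p - 2)` per
monomial. The cancelled bits convert errors relative to the largest monomial into errors relative to
`P(z)` (`similar_sub_cancelledBits`).

**Law of `λ`.** For uniform `z` the logarithm `λ` has the distribution function `4^λ / (1 + 4^λ)`
(`integral_sphereMeasure`), whose density is even, unimodal and at most `log 2 / 2`.

**Upper bound.** Let `φ(λ) = max (Ê(x) + λ x)`. It is nondecreasing and `d`-Lipschitz. Comparing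
`φ(λ ± t)` with the values of `Ê(x) + (λ ± t) x` at the ends of the window gives
`r - ℓ ≤ (2 g + ψ(λ) - ψ(λ - t)) / t`, where `ψ(λ) = φ(λ + t) - φ(λ)` has values in `[0, d t]`
(`card_window_le`). The mean of `ψ(λ) - ψ(λ - t)` is at most `d t` times the mass of
`[-t / 2, t / 2]` (`integral_sub_shift_le`), hence at most `d t² log 2 / 2`. The choice
`t = 2 √(g / d)` bounds the average by `1 + (1 + log 2) √(d g)`.

**Lower bound.** Where the cover has the second derivative `-κ`, the window has a width of about
`2 √(2 g / κ)`. The average is then about `∫ 2 √(2 g x'(λ)) dμ(λ)`, where `x(λ)` is the position of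
the maximum and `∫ x' = d`. A step function with `x' = 2 d / 5` on `|λ| < 1` and `x' = d / 10` on
`1 < |λ| < 2` is close enough to the optimum: it gives `1.3258 √(d g)`. Its profile is `depth`.
Rounding the profile to integers costs one bit of the gap, which tends to infinity with `d`, and the
effects at the ends of the pieces vanish because `√(g / d)` tends to `0`.
-/

namespace FPE


/-! ### Scales -/

theorem scale_of_ne_zero {z : ℂ} (hz : z ≠ 0) : scale z = (((scaleInt z : ℤ) : ℝ) : EReal) :=
  if_neg hz

theorem scale_zero : scale 0 = ⊥ := if_pos rfl

theorem two_zpow_scaleInt_le {z : ℂ} (hz : z ≠ 0) : (2 : ℝ) ^ scaleInt z ≤ 2 * ‖z‖ := by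
  have h0 : 0 < ‖z‖ := norm_pos_iff.2 hz
  have h : (2 : ℝ) ^ ⌊Real.logb 2 ‖z‖⌋ ≤ ‖z‖ := by
    rw [← Real.rpow_intCast]
    exact (Real.le_logb_iff_rpow_le one_lt_two h0).1 (Int.floor_le _)
  rw [scaleInt, zpow_add₀ two_ne_zero, zpow_one]
  linarith

theorem norm_lt_two_zpow_scaleInt (z : ℂ) : ‖z‖ < (2 : ℝ) ^ scaleInt z := by
  rcases eq_or_ne z 0 with rfl | hz
  · simp only [norm_zero]; positivity
  · rw [← Real.rpow_intCast]
    refine (Real.logb_lt_iff_lt_rpow one_lt_two (norm_pos_iff.2 hz)).1 ?_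
    rw [scaleInt, Int.cast_add, Int.cast_one, add_comm]
    exact Int.lt_floor_add_one _

theorem scaleInt_le_scaleInt {z w : ℂ} (hz : z ≠ 0) (h : ‖z‖ ≤ ‖w‖) : scaleInt z ≤ scaleInt w :=
  add_le_add_right (Int.floor_le_floor
    (Real.logb_le_logb_of_le one_lt_two (norm_pos_iff.2 hz) h)) 1

theorem scaleInt_le_add_of_norm_le {z w : ℂ} (hz : z ≠ 0) (n : ℤ) (h : ‖z‖ ≤ ‖w‖ * 2 ^ n) :
    scaleInt z ≤ scaleInt w + n := by
  have hz' : 0 < ‖z‖ := norm_pos_iff.2 hz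
  have hw : ‖w‖ ≠ 0 := by
    rintro h0
    rw [h0, zero_mul] at h
    exact absurd h (not_le.2 hz')
  have h1 := Real.logb_le_logb_of_le one_lt_two hz' h
  rw [Real.logb_mul hw (by positivity), ← Real.rpow_intCast,
    Real.logb_rpow two_pos (by norm_num)] at h1
  have h2 := Int.floor_le_floor h1
  rw [Int.floor_add_intCast] at h2
  unfold scaleInt
  linarith

theorem scaleInt_two_zpow (n : ℤ) : scaleInt ((2 : ℂ) ^ n) = n + 1 := by
  rw [scaleInt, norm_zpow, Complex.norm_two, ← Real.rpow_intCast,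
    Real.logb_rpow two_pos (by norm_num), Int.floor_intCast, add_comm]

theorem natCast_add_one_le_two_zpow_scaleInt (d : ℕ) :
    (d : ℝ) + 1 ≤ (2 : ℝ) ^ scaleInt (d : ℂ) := by
  have h := norm_lt_two_zpow_scaleInt (d : ℂ)
  have hs : 0 ≤ scaleInt (d : ℂ) := by
    rcases Nat.eq_zero_or_pos d with rfl | hd
    · simp [scaleInt]
    · have : 0 ≤ Real.logb 2 ‖(d : ℂ)‖ := by
        rw [Complex.norm_natCast]
        exact Real.logb_nonneg one_lt_two (by exact_mod_cast hd)
      have := Int.floor_nonneg.2 this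
      unfold scaleInt
      linarith
  obtain ⟨n, hn⟩ := Int.eq_ofNat_of_zero_le hs
  rw [Complex.norm_natCast, hn, zpow_natCast] at h
  rw [hn, zpow_natCast]
  have h' : d < 2 ^ n := by exact_mod_cast h
  exact_mod_cast h'

theorem scaleInt_natCast_pos {d : ℕ} (hd : 1 ≤ d) : 1 ≤ scaleInt (d : ℂ) := by
  have : 0 ≤ Real.logb 2 ‖(d : ℂ)‖ := by
    rw [Complex.norm_natCast]
    exact Real.logb_nonneg one_lt_two (by exact_mod_cast hd)
  have := Int.floor_nonneg.2 this
  unfold scaleInt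
  linarith

theorem similar_bot (z w : ℂ) : Similar ⊥ z w := by
  unfold Similar
  rcases eq_or_ne z w with rfl | h
  · rw [sub_self, scale_zero]; exact bot_le
  · have : max (scale z) (scale w) ≠ ⊥ := by
      intro hb
      have hz : z = 0 := by
        by_contra hz
        have := le_max_left (scale z) (scale w)
        rw [hb, scale_of_ne_zero hz] at this
        exact absurd this (not_le.2 (EReal.bot_lt_coe _))
      have hw : w = 0 := by
        by_contra hw
        have := le_max_right (scale z) (scale w)
        rw [hb, scale_of_ne_zero hw] at this
        exact absurd this (not_le.2 (EReal.bot_lt_coe _))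
      exact h (hz.trans hw.symm)
    rw [sub_eq_add_neg _ (⊥ : EReal), EReal.neg_bot, EReal.add_top_of_ne_bot this]
    have h2 : (⊤ : EReal) - 2 = ⊤ := EReal.top_sub_coe 2
    rw [h2]
    exact le_top

theorem similar_of_norm_sub_le {z w m : ℂ} (hz : z ≠ 0) {q n : ℤ}
    (hm : scaleInt m ≤ scaleInt z + n) (h : ‖z - w‖ ≤ ‖m‖ * 2 ^ (-q - 2)) :
    Similar (((q - n : ℤ) : ℝ) : EReal) z w := by
  unfold Similar
  rcases eq_or_ne (z - w) 0 with h0 | h0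
  · rw [h0, scale_zero]; exact bot_le
  · have h1 := scaleInt_le_add_of_norm_le h0 _ h
    have h2 : scaleInt (z - w) ≤ scaleInt z - (q - n) - 2 := by linarith
    calc scale (z - w) = ((scaleInt (z - w) : ℝ) : EReal) := scale_of_ne_zero h0
      _ ≤ (((scaleInt z - (q - n) - 2 : ℤ) : ℝ) : EReal) := by exact_mod_cast h2
      _ = scale z - (((q - n : ℤ) : ℝ) : EReal) - 2 := by
        rw [scale_of_ne_zero hz]; push_cast; rfl
      _ ≤ _ := EReal.sub_le_sub (EReal.sub_le_sub (le_max_left _ _) le_rfl) le_rfl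

/-! ### The concave cover -/

section Cover

variable {P : ℂ[X]}

/-- A concave function that dominates the scales of the coefficients lies above the concave
cover. The two extreme coefficients are nonzero, so that the infimum which defines the cover is
over a set that is bounded below. -/
theorem concaveCover_le (h0 : P.coeff 0 ≠ 0) {g : ℝ → ℝ}
    (hg : ConcaveOn ℝ (Set.Icc 0 (P.natDegree : ℝ)) g)
    (hs : ∀ k : ℕ, k ≤ P.natDegree → scale (P.coeff k) ≤ ((g k : ℝ) : EReal))
    {x : ℝ} (hx : x ∈ Set.Icc 0 (P.natDegree : ℝ)) : concaveCover P x ≤ g x := by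
  refine csInf_le ⟨min (scaleInt (P.coeff 0) : ℝ) (scaleInt (P.coeff P.natDegree) : ℝ), ?_⟩
    ⟨g, hg, hs, rfl⟩
  rintro y ⟨f, hf, hfs, rfl⟩
  have hP : P.coeff P.natDegree ≠ 0 := by
    rw [coeff_natDegree, leadingCoeff_ne_zero]
    rintro rfl
    exact h0 (coeff_zero 0)
  have ha := hfs 0 (Nat.zero_le _)
  have hb := hfs P.natDegree le_rfl
  rw [scale_of_ne_zero h0, EReal.coe_le_coe_iff, Nat.cast_zero] at ha
  rw [scale_of_ne_zero hP, EReal.coe_le_coe_iff] at hb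
  refine (min_le_min ha hb).trans (hf.min_le_of_mem_Icc ?_ ?_ hx)
  · exact ⟨le_rfl, Nat.cast_nonneg _⟩
  · exact ⟨Nat.cast_nonneg _, le_rfl⟩

/-- For each slope some monomial dominates the cover: the affine function of slope `-lam` through
the highest point of the scales, tilted by `lam`, is a concave majorant. -/
theorem exists_dominant_index (h0 : P.coeff 0 ≠ 0) (lam : ℝ) :
    ∃ k ≤ P.natDegree, P.coeff k ≠ 0 ∧ ∀ x ∈ Set.Icc 0 (P.natDegree : ℝ),
      concaveCover P x + lam * x ≤ scaleInt (P.coeff k) + lam * k := by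
  obtain ⟨k, hk, hmax⟩ := P.support.exists_max_image
    (fun k => (scaleInt (P.coeff k) : ℝ) + lam * k) ⟨0, mem_support_iff.2 h0⟩
  refine ⟨k, le_natDegree_of_mem_supp k hk, mem_support_iff.1 hk, fun x hx => ?_⟩
  have := concaveCover_le h0
    (g := fun x => scaleInt (P.coeff k) + lam * k + (-lam) * x) ?_ ?_ hx
  · linarith
  · exact (concaveOn_const _ (convex_Icc _ _)).add
      ((LinearMap.mul ℝ ℝ (-lam)).concaveOn (convex_Icc _ _))
  · intro j _
    rcases eq_or_ne (P.coeff j) 0 with hj | hj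
    · rw [hj, scale_zero]; exact bot_le
    · rw [scale_of_ne_zero hj, EReal.coe_le_coe_iff]
      have := hmax j (mem_support_iff.2 hj)
      linarith

theorem scaleInt_le_concaveCover {k : ℕ} (hk : k ≤ P.natDegree) (hc : P.coeff k ≠ 0) :
    (scaleInt (P.coeff k) : ℝ) ≤ concaveCover P k := by
  refine le_csInf ?_ ?_
  · -- a constant is a concave majorant
    refine ⟨_, fun _ => ∑ j ∈ P.support, |(scaleInt (P.coeff j) : ℝ)|,
      concaveOn_const _ (convex_Icc _ _), fun j _ => ?_, rfl⟩
    rcases eq_or_ne (P.coeff j) 0 with hj | hj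
    · rw [hj, scale_zero]; exact bot_le
    · rw [scale_of_ne_zero hj, EReal.coe_le_coe_iff]
      exact (le_abs_self _).trans (Finset.single_le_sum
        (f := fun j => |(scaleInt (P.coeff j) : ℝ)|) (fun _ _ => abs_nonneg _)
        (mem_support_iff.2 hj))
  · rintro y ⟨f, -, hfs, rfl⟩
    have := hfs k hk
    rwa [scale_of_ne_zero hc, EReal.coe_le_coe_iff] at this

theorem natCast_mem_Icc {k : ℕ} (hk : k ≤ P.natDegree) :
    (k : ℝ) ∈ Set.Icc 0 (P.natDegree : ℝ) := ⟨Nat.cast_nonneg _, Nat.cast_le.2 hk⟩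

theorem le_maxCover (h0 : P.coeff 0 ≠ 0) (lam : ℝ) {x : ℝ}
    (hx : x ∈ Set.Icc 0 (P.natDegree : ℝ)) : concaveCover P x + lam * x ≤ maxCover P lam := by
  obtain ⟨k, -, -, h⟩ := exists_dominant_index h0 lam
  exact le_csSup ⟨_, by rintro y ⟨x, hx, rfl⟩; exact h x hx⟩ ⟨x, hx, rfl⟩

theorem maxCover_le {lam m : ℝ} (h : ∀ x ∈ Set.Icc 0 (P.natDegree : ℝ),
    concaveCover P x + lam * x ≤ m) : maxCover P lam ≤ m := by
  refine csSup_le ⟨_, 0, ⟨le_rfl, Nat.cast_nonneg _⟩, rfl⟩ ?_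
  rintro y ⟨x, hx, rfl⟩
  exact h x hx

theorem mem_window_of_mem_levelSet {p : ℕ} {lam : ℝ} {k : ℕ} (hk : k ∈ levelSet P p lam) :
    k ∈ window P p lam :=
  Finset.mem_Icc.2 ⟨Nat.sInf_le hk, le_csSup ⟨P.natDegree, fun _ hj => hj.1⟩ hk⟩

theorem gap_nonneg (P : ℂ[X]) (p : ℕ) : 0 ≤ gap P p := by
  have : 0 ≤ scaleInt (P.natDegree : ℂ) := by
    rcases Nat.eq_zero_or_pos P.natDegree with h | h
    · simp [h, scaleInt]
    · linarith [scaleInt_natCast_pos h]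
  have : (0 : ℝ) ≤ scaleInt (P.natDegree : ℂ) := by exact_mod_cast this
  unfold gap
  positivity

/-- The dominant monomial is kept by the algorithm, and bounds the modulus of the discarded
ones. -/
theorem exists_dominant_kept (h0 : P.coeff 0 ≠ 0) (p : ℕ) (lam : ℝ) :
    ∃ k ∈ keptIndices P p lam, k ≤ P.natDegree ∧ P.coeff k ≠ 0 ∧ k ∈ levelSet P p lam ∧
      ∀ j ≤ P.natDegree, P.coeff j ≠ 0 → j ∉ keptIndices P p lam →
        scaleInt (P.coeff j) + lam * j ≤ scaleInt (P.coeff k) + lam * k - gap P p := by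
  obtain ⟨k, hk, hc, h⟩ := exists_dominant_index h0 lam
  have hg := gap_nonneg P p
  have hlev : k ∈ levelSet P p lam := by
    refine ⟨hk, ?_⟩
    have := maxCover_le h
    have := scaleInt_le_concaveCover hk hc
    linarith
  refine ⟨k, Finset.mem_inter.2 ⟨Finset.mem_filter.2 ⟨Finset.mem_range_succ_iff.2 hk, ?_⟩,
    mem_window_of_mem_levelSet hlev⟩, hk, hc, hlev, fun j hj hcj hjk => ?_⟩
  · rw [scale_of_ne_zero hc, EReal.coe_le_coe_iff]
    have := h k (natCast_mem_Icc hk)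
    linarith
  · have hjs := scaleInt_le_concaveCover hj hcj
    have hjx := h j (natCast_mem_Icc hj)
    by_cases hjl : j ∈ levelSet P p lam
    · have hjg : j ∉ goodIndices P p := fun hjg =>
        hjk (Finset.mem_inter.2 ⟨hjg, mem_window_of_mem_levelSet hjl⟩)
      have : ¬ ((concaveCover P j - gap P p : ℝ) : EReal) ≤ scale (P.coeff j) := fun hle =>
        hjg (Finset.mem_filter.2 ⟨Finset.mem_range_succ_iff.2 hj, hle⟩)
      rw [scale_of_ne_zero hcj, EReal.coe_le_coe_iff, not_le] at this
      linarith
    · have : concaveCover P j + lam * j < maxCover P lam - gap P p := by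
        by_contra hcon
        exact hjl ⟨hj, not_lt.1 hcon⟩
      have := maxCover_le h
      linarith

/-! ### Correctness -/

theorem norm_monomial_le_maxMonomial {k : ℕ} (hk : k ≤ P.natDegree) (z : ℂ) :
    ‖P.coeff k * z ^ k‖ ≤ maxMonomial P z :=
  Finset.le_sup' (fun j => ‖P.coeff j * z ^ j‖) (Finset.mem_range_succ_iff.2 hk)

theorem maxMonomial_pos (h0 : P.coeff 0 ≠ 0) (z : ℂ) : 0 < maxMonomial P z := by
  refine lt_of_lt_of_le ?_ (norm_monomial_le_maxMonomial (Nat.zero_le _) z)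
  simpa using h0

theorem norm_maxMonomial (h0 : P.coeff 0 ≠ 0) (z : ℂ) :
    ‖(maxMonomial P z : ℂ)‖ = maxMonomial P z := by
  rw [Complex.norm_real, Real.norm_of_nonneg (maxMonomial_pos h0 z).le]

theorem cancelledBits_eq_top {z : ℂ} (h0 : P.coeff 0 ≠ 0) (hz : P.eval z = 0) :
    cancelledBits P z = ⊤ := by
  have hM := maxMonomial_pos h0 z
  rw [cancelledBits, if_neg (by rw [hz, norm_zero, not_le]; exact hM), hz, scale_zero,
    scale_of_ne_zero (by exact_mod_cast hM.ne')]
  exact EReal.coe_sub_bot _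

theorem exists_cancelledBits_eq {z : ℂ} (h0 : P.coeff 0 ≠ 0) (hz : P.eval z ≠ 0) :
    ∃ n : ℤ, 0 ≤ n ∧ cancelledBits P z = ((n : ℝ) : EReal) ∧
      scaleInt (maxMonomial P z : ℂ) ≤ scaleInt (P.eval z) + n := by
  have hM := maxMonomial_pos h0 z
  have hM' : (maxMonomial P z : ℂ) ≠ 0 := by exact_mod_cast hM.ne'
  by_cases h : maxMonomial P z ≤ ‖P.eval z‖
  · refine ⟨0, le_rfl, by simp [cancelledBits, h], ?_⟩
    rw [add_zero]
    exact scaleInt_le_scaleInt hM' (by rwa [norm_maxMonomial h0])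
  · refine ⟨scaleInt (maxMonomial P z : ℂ) - scaleInt (P.eval z), ?_, ?_, by linarith⟩
    · exact sub_nonneg.2 (scaleInt_le_scaleInt hz (by
        rw [norm_maxMonomial h0]; exact (not_le.1 h).le))
    · rw [cancelledBits, if_neg h, scale_of_ne_zero hM', scale_of_ne_zero hz]
      push_cast
      rfl

theorem cancelledBits_nonneg (h0 : P.coeff 0 ≠ 0) (z : ℂ) : 0 ≤ cancelledBits P z := by
  rcases eq_or_ne (P.eval z) 0 with hz | hz
  · rw [cancelledBits_eq_top h0 hz]; exact le_top
  · obtain ⟨n, hn, h, -⟩ := exists_cancelledBits_eq h0 hz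
    rw [h]
    exact_mod_cast hn

theorem rpow_mul_natCast {z : ℂ} (hz : z ≠ 0) (k : ℕ) :
    (2 : ℝ) ^ (Real.logb 2 ‖z‖ * k) = ‖z‖ ^ k := by
  rw [Real.rpow_mul two_pos.le, Real.rpow_logb two_pos (by norm_num) (norm_pos_iff.2 hz),
    Real.rpow_natCast]

/-- A monomial that the algorithm discards is small. -/
theorem norm_dropped_le (h0 : P.coeff 0 ≠ 0) {z : ℂ} (hz : z ≠ 0) {p j : ℕ}
    (hj : j ≤ P.natDegree) (hjk : j ∉ keptIndices P p (Real.logb 2 ‖z‖)) :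
    ‖P.coeff j * z ^ j‖ ≤ maxMonomial P z *
      ((2 : ℝ) ^ (-(p : ℤ) - 2) * ((2 : ℝ) ^ scaleInt (P.natDegree : ℂ))⁻¹) := by
  have hM := maxMonomial_pos h0 z
  rcases eq_or_ne (P.coeff j) 0 with hc | hc
  · rw [hc, zero_mul, norm_zero]; positivity
  obtain ⟨k, -, hk, hck, -, h⟩ := exists_dominant_kept h0 p (Real.logb 2 ‖z‖)
  have key := Real.rpow_le_rpow_of_exponent_le one_le_two (h j hj hc hjk)
  have e : (scaleInt (P.coeff k) : ℝ) + Real.logb 2 ‖z‖ * k - gap P p =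
      (scaleInt (P.coeff k) : ℝ) + Real.logb 2 ‖z‖ * k +
        ((-(p : ℤ) - 2 - scaleInt (P.natDegree : ℂ) - 1 : ℤ) : ℝ) := by
    unfold gap; push_cast; ring
  rw [e, Real.rpow_add two_pos, Real.rpow_add two_pos, Real.rpow_add two_pos,
    Real.rpow_intCast, Real.rpow_intCast, Real.rpow_intCast, rpow_mul_natCast hz,
    rpow_mul_natCast hz, zpow_sub₀ two_ne_zero (_ - _) 1, zpow_sub₀ two_ne_zero (_ - _) (scaleInt _),
    zpow_one] at key
  have h1 := norm_lt_two_zpow_scaleInt (P.coeff j)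
  have h2 := two_zpow_scaleInt_le hck
  have h3 := norm_monomial_le_maxMonomial hk z
  rw [norm_mul, norm_pow] at h3 ⊢
  calc ‖P.coeff j‖ * ‖z‖ ^ j ≤ (2 : ℝ) ^ scaleInt (P.coeff j) * ‖z‖ ^ j := by gcongr
    _ ≤ _ := key
    _ ≤ (2 * ‖P.coeff k‖) * ‖z‖ ^ k *
        ((2 : ℝ) ^ (-(p : ℤ) - 2) / (2 : ℝ) ^ scaleInt (P.natDegree : ℂ) / 2) := by gcongr
    _ = (‖P.coeff k‖ * ‖z‖ ^ k) *
        ((2 : ℝ) ^ (-(p : ℤ) - 2) * ((2 : ℝ) ^ scaleInt (P.natDegree : ℂ))⁻¹) := by ring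
    _ ≤ _ := by gcongr

theorem keptIndices_subset (P : ℂ[X]) (p : ℕ) (lam : ℝ) :
    keptIndices P p lam ⊆ Finset.range (P.natDegree + 1) :=
  Finset.inter_subset_left.trans (Finset.filter_subset _ _)

theorem eval_subexpression (p : ℕ) (lam : ℝ) (z : ℂ) :
    (subexpression P p lam).eval z = ∑ k ∈ keptIndices P p lam, P.coeff k * z ^ k := by
  simp [subexpression, eval_finsetSum]

theorem norm_eval_sub_subexpression_le (h0 : P.coeff 0 ≠ 0) {z : ℂ} (hz : z ≠ 0) (p : ℕ) :
    ‖P.eval z - (subexpression P p (Real.logb 2 ‖z‖)).eval z‖ ≤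
      maxMonomial P z * (2 : ℝ) ^ (-(p : ℤ) - 2) := by
  have hM := maxMonomial_pos h0 z
  set S := keptIndices P p (Real.logb 2 ‖z‖) with hS
  have hsub : S ⊆ Finset.range (P.natDegree + 1) := keptIndices_subset _ _ _
  obtain ⟨k, hkS, -⟩ := exists_dominant_kept h0 p (Real.logb 2 ‖z‖)
  -- the dominant monomial is kept, hence at most `d` monomials are discarded
  have hcard : (Finset.range (P.natDegree + 1) \ S).card ≤ P.natDegree := by
    have h1 := Finset.card_sdiff_add_card_eq_card hsub
    have h2 : 0 < S.card := Finset.card_pos.2 ⟨k, hkS⟩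
    rw [Finset.card_range] at h1
    omega
  rw [eval_subexpression, eval_eq_sum_range, ← Finset.sum_sdiff hsub, add_sub_cancel_right]
  refine (norm_sum_le_of_le _ (f := fun j => P.coeff j * z ^ j) fun j hj => norm_dropped_le h0 hz
    (Finset.mem_range_succ_iff.1 (Finset.mem_sdiff.1 hj).1) (Finset.mem_sdiff.1 hj).2).trans ?_
  rw [Finset.sum_const, nsmul_eq_mul]
  have hd : ((Finset.range (P.natDegree + 1) \ S).card : ℝ) ≤
      (2 : ℝ) ^ scaleInt (P.natDegree : ℂ) := by
    have := natCast_add_one_le_two_zpow_scaleInt P.natDegree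
    have : ((Finset.range (P.natDegree + 1) \ S).card : ℝ) ≤ P.natDegree := by
      exact_mod_cast hcard
    linarith
  calc _ ≤ (2 : ℝ) ^ scaleInt (P.natDegree : ℂ) * (maxMonomial P z *
      ((2 : ℝ) ^ (-(p : ℤ) - 2) * ((2 : ℝ) ^ scaleInt (P.natDegree : ℂ))⁻¹)) := by gcongr
    _ = _ := by field_simp

theorem abs_roundReal_sub_le (p : ℕ) {x : ℝ} (hx : x ≠ 0) :
    |roundReal p x - x| ≤ ulp p x / 2 := by
  have hu : 0 < ulp p x := by unfold ulp; positivity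
  rw [roundReal, if_neg hx]
  have h1 := Int.floor_le (|x| / ulp p x + 1 / 2)
  have h2 := Int.lt_floor_add_one (|x| / ulp p x + 1 / 2)
  set n := ⌊|x| / ulp p x + 1 / 2⌋
  have hn : |(n : ℝ) - |x| / ulp p x| ≤ 1 / 2 := abs_le.2 ⟨by linarith, by linarith⟩
  have e : (SignType.sign x : ℝ) * n * ulp p x - x =
      (SignType.sign x : ℝ) * (((n : ℝ) - |x| / ulp p x) * ulp p x) := by
    have : |x| / ulp p x * ulp p x = |x| := div_mul_cancel₀ _ hu.ne'
    rw [sub_mul, this, mul_sub, sign_mul_abs]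
    ring
  have hs : |(SignType.sign x : ℝ)| = 1 := by
    rcases lt_or_gt_of_ne hx with h | h
    · simp [sign_neg h]
    · simp [sign_pos h]
  rw [e, abs_mul, hs, one_mul, abs_mul, abs_of_pos hu]
  nlinarith

theorem abs_roundReal_sub_le_of_abs_le (p : ℕ) {x : ℝ} {a : ℂ} (h : |x| ≤ ‖a‖) :
    |roundReal p x - x| ≤ (2 : ℝ) ^ scaleInt a * (2 : ℝ) ^ (-(p : ℤ) - 2) := by
  rcases eq_or_ne x 0 with rfl | hx
  · rw [roundReal, if_pos rfl, sub_zero, abs_zero]; positivity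
  refine (abs_roundReal_sub_le p hx).trans ?_
  have hs : scaleInt (x : ℂ) ≤ scaleInt a :=
    scaleInt_le_scaleInt (by exact_mod_cast hx) (by rwa [Complex.norm_real, Real.norm_eq_abs])
  calc ulp p x / 2 = (2 : ℝ) ^ (scaleInt (x : ℂ) + (-(p : ℤ) - 2)) := by
        rw [ulp, div_eq_mul_inv, ← zpow_neg_one, ← zpow_add₀ two_ne_zero]
        congr 1
        ring
    _ ≤ (2 : ℝ) ^ (scaleInt a + (-(p : ℤ) - 2)) := by gcongr; exact one_le_two
    _ = _ := zpow_add₀ two_ne_zero _ _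

/-- The modulus of a rounding error is at most `√2` times the errors of the two parts; the
cruder constant `3 / 2` is sufficient, and `2` would not be. -/
theorem norm_roundComplex_sub_le (p : ℕ) (a : ℂ) :
    ‖roundComplex p a - a‖ ≤ 3 * ‖a‖ * (2 : ℝ) ^ (-(p : ℤ) - 2) := by
  rcases eq_or_ne a 0 with rfl | ha
  · have : roundComplex p 0 = 0 := by
      apply Complex.ext <;> simp [roundComplex, roundReal]
    simp [this]
  have h1 := abs_roundReal_sub_le_of_abs_le p (Complex.abs_re_le_norm a)
  have h2 := abs_roundReal_sub_le_of_abs_le p (Complex.abs_im_le_norm a)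
  have h3 := two_zpow_scaleInt_le ha
  have h4 : √2 ≤ 3 / 2 := Real.sqrt_le_iff.2 ⟨by norm_num, by norm_num⟩
  calc _ ≤ √2 * max |(roundComplex p a - a).re| |(roundComplex p a - a).im| :=
        Complex.norm_le_sqrt_two_mul_max _
    _ ≤ 3 / 2 * ((2 : ℝ) ^ scaleInt a * (2 : ℝ) ^ (-(p : ℤ) - 2)) := by
        gcongr
        exact max_le h1 h2
    _ ≤ 3 / 2 * ((2 * ‖a‖) * (2 : ℝ) ^ (-(p : ℤ) - 2)) := by gcongr
    _ = _ := by ring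

theorem norm_eval_sub_roundedSubexpression_le (h0 : P.coeff 0 ≠ 0) {z : ℂ} (hz : z ≠ 0)
    (p : ℕ) :
    ‖P.eval z - (roundedSubexpression P p (Real.logb 2 ‖z‖)).eval z‖ ≤
      maxMonomial P z * (2 : ℝ) ^ (-((p : ℤ) - scaleInt (P.natDegree : ℂ) - 2) - 2) := by
  have hM := maxMonomial_pos h0 z
  have h1 := norm_eval_sub_subexpression_le h0 hz p
  set S := keptIndices P p (Real.logb 2 ‖z‖) with hS
  have hsub : S ⊆ Finset.range (P.natDegree + 1) := keptIndices_subset _ _ _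
  have h2 : ‖(roundedSubexpression P p (Real.logb 2 ‖z‖)).eval z -
      (subexpression P p (Real.logb 2 ‖z‖)).eval z‖ ≤
      ((P.natDegree : ℝ) + 1) * (3 * maxMonomial P z * (2 : ℝ) ^ (-(p : ℤ) - 2)) := by
    have e : (roundedSubexpression P p (Real.logb 2 ‖z‖)).eval z -
        (subexpression P p (Real.logb 2 ‖z‖)).eval z =
        ∑ k ∈ S, (roundComplex p (P.coeff k) - P.coeff k) * z ^ k := by
      simp [roundedSubexpression, subexpression, eval_finsetSum, sub_mul, hS]
    rw [e]
    refine (norm_sum_le_of_le _ (f := fun k => (roundComplex p (P.coeff k) - P.coeff k) * z ^ k)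
      (n := fun _ => 3 * maxMonomial P z * (2 : ℝ) ^ (-(p : ℤ) - 2)) fun k hk => ?_).trans ?_
    · have h3 := norm_monomial_le_maxMonomial (Finset.mem_range_succ_iff.1 (hsub hk)) z
      have h4 := norm_roundComplex_sub_le p (P.coeff k)
      rw [norm_mul] at h3 ⊢
      calc _ ≤ 3 * ‖P.coeff k‖ * (2 : ℝ) ^ (-(p : ℤ) - 2) * ‖z ^ k‖ := by gcongr
        _ = 3 * (‖P.coeff k‖ * ‖z ^ k‖) * (2 : ℝ) ^ (-(p : ℤ) - 2) := by ring
        _ ≤ _ := by gcongr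
    · rw [Finset.sum_const, nsmul_eq_mul]
      have := Finset.card_le_card hsub
      rw [Finset.card_range] at this
      gcongr
      exact_mod_cast this
  have h3 := natCast_add_one_le_two_zpow_scaleInt P.natDegree
  have e : (2 : ℝ) ^ (-((p : ℤ) - scaleInt (P.natDegree : ℂ) - 2) - 2) =
      4 * (2 : ℝ) ^ scaleInt (P.natDegree : ℂ) * (2 : ℝ) ^ (-(p : ℤ) - 2) := by
    rw [show (4 : ℝ) = 2 ^ (2 : ℤ) by norm_num, ← zpow_add₀ two_ne_zero, ← zpow_add₀ two_ne_zero]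
    congr 1
    ring
  rw [e, ← sub_sub_sub_cancel_right _ _ ((subexpression P p (Real.logb 2 ‖z‖)).eval z)]
  refine (norm_sub_le _ _).trans ((add_le_add h1 h2).trans ?_)
  have hd : (1 : ℝ) ≤ (2 : ℝ) ^ scaleInt (P.natDegree : ℂ) :=
    le_trans (by linarith [Nat.cast_nonneg (α := ℝ) P.natDegree]) h3
  have hpos : 0 < maxMonomial P z * (2 : ℝ) ^ (-(p : ℤ) - 2) := by positivity
  nlinarith [mul_le_mul_of_nonneg_right h3 hpos.le, mul_le_mul_of_nonneg_right hd hpos.le]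

/-- A bound on the absolute error relative to the largest monomial gives the similarity, with
the cancelled bits taken into account. -/
theorem similar_sub_cancelledBits (h0 : P.coeff 0 ≠ 0) {z w : ℂ} {q : ℤ}
    (h : ‖P.eval z - w‖ ≤ maxMonomial P z * (2 : ℝ) ^ (-q - 2)) :
    Similar (((q : ℝ) : EReal) - cancelledBits P z) (P.eval z) w := by
  rcases eq_or_ne (P.eval z) 0 with hPz | hPz
  · rw [cancelledBits_eq_top h0 hPz, show ((q : ℝ) : EReal) - ⊤ = ⊥ from rfl]
    exact similar_bot _ _
  · obtain ⟨n, -, hn, hs⟩ := exists_cancelledBits_eq h0 hPz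
    rw [hn]
    rw [← norm_maxMonomial h0] at h
    have := similar_of_norm_sub_le hPz hs h
    push_cast at this
    exact this

theorem correctness (h0 : P.coeff 0 ≠ 0) (hd : 1 ≤ P.natDegree) (p : ℕ) {z : ℂ} (hz : z ≠ 0) :
    0 ≤ cancelledBits P z ∧
    Similar ((p : EReal) - cancelledBits P z) (P.eval z)
      ((subexpression P p (Real.logb 2 ‖z‖)).eval z) ∧
    ((∀ k ∈ keptIndices P p (Real.logb 2 ‖z‖), roundComplex p (P.coeff k) = P.coeff k) →
      Similar ((p : EReal) - cancelledBits P z) (P.eval z)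
        ((roundedSubexpression P p (Real.logb 2 ‖z‖)).eval z)) ∧
    Similar ((p : EReal) - cancelledBits P z - scale (P.natDegree : ℂ) - 2) (P.eval z)
      ((roundedSubexpression P p (Real.logb 2 ‖z‖)).eval z) := by
  have h1 : Similar ((p : EReal) - cancelledBits P z) (P.eval z)
      ((subexpression P p (Real.logb 2 ‖z‖)).eval z) := by
    have := similar_sub_cancelledBits h0 (norm_eval_sub_subexpression_le h0 hz p)
    exact_mod_cast this
  refine ⟨cancelledBits_nonneg h0 z, h1, fun h => ?_, ?_⟩
  · have : roundedSubexpression P p (Real.logb 2 ‖z‖) = subexpression P p (Real.logb 2 ‖z‖) :=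
      Finset.sum_congr rfl fun k hk => by rw [h k hk]
    rwa [this]
  · have h2 := similar_sub_cancelledBits h0 (norm_eval_sub_roundedSubexpression_le h0 hz p)
    have hd' : (P.natDegree : ℂ) ≠ 0 := by
      exact_mod_cast (Nat.one_le_iff_ne_zero.1 hd)
    convert h2 using 1
    rw [scale_of_ne_zero hd']
    rcases eq_or_ne (P.eval z) 0 with hPz | hPz
    · rw [cancelledBits_eq_top h0 hPz]
      simp [sub_eq_add_neg]
    · obtain ⟨n, -, hn, -⟩ := exists_cancelledBits_eq h0 hPz
      rw [hn]
      have : (p : ℝ) - n - scaleInt (P.natDegree : ℂ) - 2 =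
        ((p : ℤ) - scaleInt (P.natDegree : ℂ) - 2 : ℤ) - (n : ℝ) := by push_cast; ring
      rw [← EReal.coe_natCast, show (2 : EReal) = ((2 : ℝ) : EReal) from rfl, ← EReal.coe_sub,
        ← EReal.coe_sub, ← EReal.coe_sub, ← EReal.coe_sub, this]

end Cover


/-! ### The law of the logarithm of the modulus of a uniform point of the sphere -/

/-- The distribution function of `log₂ |z|` for a uniform point `z` of the Riemann sphere. -/
noncomputable def logCdf (l : ℝ) : ℝ := 1 - (1 + (4 : ℝ) ^ l)⁻¹

/-- The density of `log₂ |z|` for a uniform point `z` of the Riemann sphere. -/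
noncomputable def logDensity (l : ℝ) : ℝ := Real.log 4 * (4 : ℝ) ^ l / (1 + (4 : ℝ) ^ l) ^ 2

theorem logDensity_nonneg (l : ℝ) : 0 ≤ logDensity l := by
  have := Real.log_nonneg (show (1 : ℝ) ≤ 4 by norm_num)
  unfold logDensity
  positivity

theorem hasDerivAt_logCdf (l : ℝ) : HasDerivAt logCdf (logDensity l) l := by
  have h := (Real.hasStrictDerivAt_const_rpow (show (0 : ℝ) < 4 by norm_num) l).hasDerivAt
  have hpos : (0 : ℝ) < 4 ^ l := by positivity
  refine (((h.const_add 1).inv (by positivity)).const_sub 1).congr_deriv ?_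
  unfold logDensity
  ring

theorem continuous_logDensity : Continuous logDensity := by
  have h : Continuous fun l : ℝ => (4 : ℝ) ^ l :=
    Real.continuous_const_rpow (by norm_num)
  unfold logDensity
  refine (continuous_const.mul h).div ((continuous_const.add h).pow 2) fun l => ?_
  positivity

theorem tendsto_logCdf_atTop : Filter.Tendsto logCdf Filter.atTop (nhds 1) := by
  have h := tendsto_rpow_atTop_of_base_gt_one (4 : ℝ) (by norm_num)
  have := (tendsto_inv_atTop_zero.comp (Filter.tendsto_atTop_add_const_left _ 1 h)).const_sub 1
  rwa [sub_zero] at this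

theorem tendsto_logCdf_atBot : Filter.Tendsto logCdf Filter.atBot (nhds 0) := by
  have h := tendsto_rpow_atBot_of_base_gt_one (4 : ℝ) (by norm_num)
  have := ((h.const_add 1).inv₀ (by norm_num)).const_sub 1
  simp only [add_zero, inv_one, sub_self] at this
  exact this

theorem integrable_logDensity : Integrable logDensity := by
  rw [← integrableOn_univ, ← Set.Iic_union_Ioi (a := (0 : ℝ))]
  refine IntegrableOn.union ?_ ?_
  · exact integrableOn_Iic_of_intervalIntegral_norm_bounded (l := Filter.atBot) (a := id) 1 0
      (fun a => (continuous_logDensity.integrableOn_Icc).mono_set Set.Ioc_subset_Icc_self)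
      Filter.tendsto_id (by
        filter_upwards with a
        simp only [Real.norm_of_nonneg (logDensity_nonneg _), id]
        rw [intervalIntegral.integral_eq_sub_of_hasDerivAt (fun x _ => hasDerivAt_logCdf x)
          (continuous_logDensity.intervalIntegrable _ _)]
        have h1 : (0 : ℝ) < (1 + (4 : ℝ) ^ (0 : ℝ))⁻¹ := by positivity
        have h2 : (1 + (4 : ℝ) ^ a)⁻¹ ≤ 1 := inv_le_one_of_one_le₀ (by
          have : (0 : ℝ) < 4 ^ a := by positivity
          linarith)
        unfold logCdf
        linarith)
  · exact integrableOn_Ioi_deriv_of_nonneg' (fun x _ => hasDerivAt_logCdf x)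
      (fun x _ => logDensity_nonneg x) tendsto_logCdf_atTop

theorem integral_logDensity : ∫ l, logDensity l = 1 := by
  rw [integral_of_hasDerivAt_of_tendsto hasDerivAt_logCdf integrable_logDensity
    tendsto_logCdf_atBot tendsto_logCdf_atTop, sub_zero]

theorem setIntegral_logDensity_Ioc {a b : ℝ} (h : a ≤ b) :
    ∫ l in Set.Ioc a b, logDensity l = logCdf b - logCdf a := by
  rw [← intervalIntegral.integral_of_le h,
    intervalIntegral.integral_eq_sub_of_hasDerivAt (fun x _ => hasDerivAt_logCdf x)
      (continuous_logDensity.intervalIntegrable _ _)]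

theorem four_rpow_eq (l : ℝ) : (4 : ℝ) ^ l = ((2 : ℝ) ^ l) ^ 2 := by
  rw [← Real.rpow_natCast, ← Real.rpow_mul two_pos.le, mul_comm, Real.rpow_mul two_pos.le]
  norm_num

theorem logDensity_eq (l : ℝ) :
    logDensity l = Real.log 4 / ((2 : ℝ) ^ l + (2 : ℝ) ^ (-l)) ^ 2 := by
  have h : (0 : ℝ) < 2 ^ l := by positivity
  rw [logDensity, four_rpow_eq, Real.rpow_neg two_pos.le]
  field_simp
  ring

theorem logDensity_le_of_abs_le {a b : ℝ} (h : |a| ≤ |b|) : logDensity b ≤ logDensity a := by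
  have h4 := Real.log_nonneg (show (1 : ℝ) ≤ 4 by norm_num)
  have key : ∀ l : ℝ, (2 : ℝ) ^ l + (2 : ℝ) ^ (-l) = 2 * Real.cosh (Real.log 2 * l) := by
    intro l
    rw [Real.cosh_eq, Real.rpow_def_of_pos two_pos, Real.rpow_def_of_pos two_pos, mul_neg]
    ring
  have hc : Real.cosh (Real.log 2 * a) ≤ Real.cosh (Real.log 2 * b) := by
    rw [Real.cosh_le_cosh, abs_mul, abs_mul]
    gcongr
  have := Real.cosh_pos (Real.log 2 * a)
  rw [logDensity_eq, logDensity_eq, key, key]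
  gcongr

theorem logDensity_le (l : ℝ) : logDensity l ≤ Real.log 2 / 2 := by
  refine (logDensity_le_of_abs_le (a := 0) (by simp)).trans_eq ?_
  rw [logDensity, Real.rpow_zero, show (4 : ℝ) = 2 ^ 2 by norm_num, Real.log_pow]
  push_cast
  ring

theorem image_two_rpow_univ : (fun l : ℝ => (2 : ℝ) ^ l) '' Set.univ = Set.Ioi 0 := by
  ext y
  simp only [Set.image_univ, Set.mem_range, Set.mem_Ioi]
  constructor
  · rintro ⟨l, rfl⟩; positivity
  · intro hy
    exact ⟨Real.logb 2 y, Real.rpow_logb two_pos (by norm_num) hy⟩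

theorem hasDerivWithinAt_two_rpow (l : ℝ) : HasDerivWithinAt (fun l : ℝ => (2 : ℝ) ^ l)
    ((2 : ℝ) ^ l * Real.log 2) Set.univ l :=
  (Real.hasStrictDerivAt_const_rpow two_pos l).hasDerivAt.hasDerivWithinAt

theorem injOn_two_rpow : Set.InjOn (fun l : ℝ => (2 : ℝ) ^ l) Set.univ :=
  (Real.strictMono_rpow_of_base_gt_one one_lt_two).injective.injOn

/-- The integrand in the coordinate `l = log₂ |z|`: the Jacobian of polar coordinates and of
`l ↦ 2 ^ l` turn the density of the sphere into the logistic density, up to `2 π`. -/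
theorem jacobian_smul_eq (F : ℝ → ℝ) (l : ℝ) :
    |(2 : ℝ) ^ l * Real.log 2| • (((2 : ℝ) ^ l) ^ (2 - 1) • (1 / (Real.pi * (1 +
      ((2 : ℝ) ^ l) ^ 2) ^ 2) * F (Real.logb 2 ((2 : ℝ) ^ l)))) =
      (2 * Real.pi)⁻¹ * (F l * logDensity l) := by
  have h : (0 : ℝ) < 2 ^ l := by positivity
  have h2 := Real.log_pos one_lt_two
  have hpi := Real.pi_pos
  rw [abs_of_pos (by positivity), Real.logb_rpow two_pos (by norm_num), logDensity, four_rpow_eq,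
    show (4 : ℝ) = 2 ^ 2 by norm_num, Real.log_pow]
  simp only [smul_eq_mul]
  push_cast
  field_simp

theorem measurable_sphereDensity :
    Measurable fun z : ℂ => ENNReal.ofReal (1 / (Real.pi * (1 + ‖z‖ ^ 2) ^ 2)) := by
  fun_prop

theorem toReal_sphereDensity (z : ℂ) :
    (ENNReal.ofReal (1 / (Real.pi * (1 + ‖z‖ ^ 2) ^ 2))).toReal =
      1 / (Real.pi * (1 + ‖z‖ ^ 2) ^ 2) := by
  have := Real.pi_pos
  exact ENNReal.toReal_ofReal (by positivity)

theorem integrable_sphereMeasure_iff (F : ℝ → ℝ) :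
    Integrable (fun z : ℂ => F (Real.logb 2 ‖z‖)) sphereMeasure ↔
      Integrable fun l => F l * logDensity l := by
  rw [sphereMeasure, integrable_withDensity_iff_integrable_smul' measurable_sphereDensity
    (Filter.Eventually.of_forall fun _ => ENNReal.ofReal_lt_top)]
  simp only [toReal_sphereDensity, smul_eq_mul]
  rw [integrable_fun_norm_addHaar volume
    (f := fun y : ℝ => 1 / (Real.pi * (1 + y ^ 2) ^ 2) * F (Real.logb 2 y)),
    Complex.finrank_real_complex, ← image_two_rpow_univ,
    integrableOn_image_iff_integrableOn_abs_deriv_smul MeasurableSet.univ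
      (fun l _ => hasDerivWithinAt_two_rpow l) injOn_two_rpow, integrableOn_univ]
  simp only [jacobian_smul_eq]
  exact integrable_const_mul_iff (by simp [Real.pi_ne_zero]) _

theorem integral_sphereMeasure (F : ℝ → ℝ) :
    ∫ z : ℂ, F (Real.logb 2 ‖z‖) ∂sphereMeasure = ∫ l, F l * logDensity l := by
  rw [sphereMeasure, integral_withDensity_eq_integral_toReal_smul measurable_sphereDensity
    (Filter.Eventually.of_forall fun _ => ENNReal.ofReal_lt_top)]
  simp only [toReal_sphereDensity, smul_eq_mul]
  rw [integral_fun_norm_addHaar volume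
    (fun y : ℝ => 1 / (Real.pi * (1 + y ^ 2) ^ 2) * F (Real.logb 2 y)),
    Complex.finrank_real_complex, ← image_two_rpow_univ,
    integral_image_eq_integral_abs_deriv_smul MeasurableSet.univ
      (fun l _ => hasDerivWithinAt_two_rpow l) injOn_two_rpow, setIntegral_univ]
  simp only [jacobian_smul_eq]
  rw [integral_const_mul, Measure.real, Complex.volume_ball]
  have := Real.pi_ne_zero
  simp
  field_simp


/-! ### The upper bound of the average -/

section Upper

variable {P : ℂ[X]}

theorem levelSet_nonempty (h0 : P.coeff 0 ≠ 0) (p : ℕ) (lam : ℝ) :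
    (levelSet P p lam).Nonempty := by
  obtain ⟨k, -, -, -, h, -⟩ := exists_dominant_kept h0 p lam
  exact ⟨k, h⟩

theorem levelSet_bddAbove (P : ℂ[X]) (p : ℕ) (lam : ℝ) : BddAbove (levelSet P p lam) :=
  ⟨P.natDegree, fun _ hj => hj.1⟩

theorem mem_window_iff (h0 : P.coeff 0 ≠ 0) {p : ℕ} {lam : ℝ} {k : ℕ} :
    k ∈ window P p lam ↔
      (∃ i, i ≤ k ∧ i ∈ levelSet P p lam) ∧ ∃ j, k ≤ j ∧ j ∈ levelSet P p lam := by
  have hne := levelSet_nonempty h0 p lam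
  have hb := levelSet_bddAbove P p lam
  rw [window, Finset.mem_Icc]
  constructor
  · rintro ⟨h1, h2⟩
    exact ⟨⟨_, h1, Nat.sInf_mem hne⟩, ⟨_, h2, Nat.sSup_mem hne hb⟩⟩
  · rintro ⟨⟨i, hi, hi'⟩, ⟨j, hj, hj'⟩⟩
    exact ⟨(Nat.sInf_le hi').trans hi, hj.trans (le_csSup hb hj')⟩

theorem window_subset_range (h0 : P.coeff 0 ≠ 0) (p : ℕ) (lam : ℝ) :
    window P p lam ⊆ Finset.range (P.natDegree + 1) := by
  intro k hk
  obtain ⟨-, j, hj, hj'⟩ := (mem_window_iff h0).1 hk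
  exact Finset.mem_range_succ_iff.2 (hj.trans hj'.1)

theorem maxCover_le_add (h0 : P.coeff 0 ≠ 0) (lam : ℝ) {t : ℝ} (ht : 0 ≤ t) :
    maxCover P lam ≤ maxCover P (lam + t) := by
  refine maxCover_le fun x hx => ?_
  have := le_maxCover h0 (lam + t) hx
  nlinarith [mul_nonneg ht hx.1]

theorem maxCover_add_le (h0 : P.coeff 0 ≠ 0) (lam : ℝ) {t : ℝ} (ht : 0 ≤ t) :
    maxCover P (lam + t) ≤ maxCover P lam + P.natDegree * t := by
  refine maxCover_le fun x hx => ?_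
  have := le_maxCover h0 lam hx
  nlinarith [mul_le_mul_of_nonneg_right hx.2 ht]

theorem continuous_maxCover (h0 : P.coeff 0 ≠ 0) : Continuous (maxCover P) := by
  refine (LipschitzWith.of_le_add_mul (P.natDegree : NNReal) fun x y => ?_).continuous
  rw [Real.dist_eq]
  push_cast
  rcases le_total x y with h | h
  · have := maxCover_le_add h0 x (sub_nonneg.2 h)
    rw [add_sub_cancel] at this
    have : 0 ≤ (P.natDegree : ℝ) * |x - y| := by positivity
    linarith
  · have := maxCover_add_le h0 y (sub_nonneg.2 h)
    rwa [add_sub_cancel, ← abs_of_nonneg (sub_nonneg.2 h)] at this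

theorem measurableSet_mem_levelSet (h0 : P.coeff 0 ≠ 0) (p k : ℕ) :
    MeasurableSet {lam : ℝ | k ∈ levelSet P p lam} := by
  by_cases hk : k ≤ P.natDegree
  · have : {lam : ℝ | k ∈ levelSet P p lam} =
        {lam | maxCover P lam - gap P p ≤ concaveCover P k + lam * k} := by
      ext lam
      exact and_iff_right hk
    rw [this]
    exact (isClosed_le ((continuous_maxCover h0).sub continuous_const)
      (continuous_const.add (continuous_id.mul continuous_const))).measurableSet
  · have : {lam : ℝ | k ∈ levelSet P p lam} = ∅ :=
      Set.eq_empty_of_forall_notMem fun _ h => hk h.1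
    rw [this]
    exact MeasurableSet.empty

theorem measurableSet_mem_window (h0 : P.coeff 0 ≠ 0) (p k : ℕ) :
    MeasurableSet {lam : ℝ | k ∈ window P p lam} := by
  simp only [mem_window_iff h0, Set.ofPred_and, Set.ofPred_exists]
  refine (MeasurableSet.iUnion fun i => ?_).inter (MeasurableSet.iUnion fun i => ?_)
  · exact (MeasurableSet.const _).inter (measurableSet_mem_levelSet h0 p i)
  · exact (MeasurableSet.const _).inter (measurableSet_mem_levelSet h0 p i)

theorem measurable_card_window (h0 : P.coeff 0 ≠ 0) (p : ℕ) :
    Measurable fun lam : ℝ => ((window P p lam).card : ℝ) := by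
  have : (fun lam : ℝ => ((window P p lam).card : ℝ)) = fun lam =>
      ∑ k ∈ Finset.range (P.natDegree + 1),
        Set.indicator {lam : ℝ | k ∈ window P p lam} (fun _ => (1 : ℝ)) lam := by
    ext lam
    simp only [Set.indicator_apply, Set.mem_ofPred_eq]
    rw [Finset.sum_boole, Finset.filter_mem_eq_inter,
      Finset.inter_eq_right.2 (window_subset_range h0 p lam)]
  rw [this]
  exact Finset.measurable_sum _ fun k _ =>
    measurable_const.indicator (measurableSet_mem_window h0 p k)

theorem card_window_le_natDegree_add_one (h0 : P.coeff 0 ≠ 0) (p : ℕ) (lam : ℝ) :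
    ((window P p lam).card : ℝ) ≤ P.natDegree + 1 := by
  have := Finset.card_le_card (window_subset_range h0 p lam)
  rw [Finset.card_range] at this
  exact_mod_cast this

theorem integrable_card_window_mul (h0 : P.coeff 0 ≠ 0) (p : ℕ) :
    Integrable fun lam : ℝ => ((window P p lam).card : ℝ) * logDensity lam := by
  refine integrable_logDensity.bdd_mul (c := P.natDegree + 1)
    (measurable_card_window h0 p).aestronglyMeasurable (Filter.Eventually.of_forall fun l => ?_)
  rw [Real.norm_of_nonneg (Nat.cast_nonneg _)]
  exact card_window_le_natDegree_add_one h0 p l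

theorem integrable_windowCard (h0 : P.coeff 0 ≠ 0) (p : ℕ) :
    Integrable (windowCard P p) sphereMeasure :=
  (integrable_sphereMeasure_iff fun lam => ((window P p lam).card : ℝ)).2
    (integrable_card_window_mul h0 p)

theorem avgWindowCard_eq (P : ℂ[X]) (p : ℕ) :
    avgWindowCard P p = ∫ lam, ((window P p lam).card : ℝ) * logDensity lam :=
  integral_sphereMeasure fun lam => ((window P p lam).card : ℝ)

/-- The function `φ(l) = maxCover P l` bounds both ends of the window: the line of slope `r`
through `(l, φ(l) - gap)` lies below the graph of `φ`, and in particular so does its point at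
`l + t`; similarly for the left end at `l - t`. -/
theorem card_window_le (h0 : P.coeff 0 ≠ 0) (p : ℕ) (l : ℝ) {t : ℝ} (ht : 0 < t) :
    ((window P p l).card : ℝ) ≤ 1 + 2 * gap P p / t +
      t⁻¹ * ((maxCover P (l + t) - maxCover P l) -
        (maxCover P (l - t + t) - maxCover P (l - t))) := by
  have hne := levelSet_nonempty h0 p l
  have hb := levelSet_bddAbove P p l
  obtain ⟨ha, ha'⟩ := Nat.sInf_mem hne
  obtain ⟨hr, hr'⟩ := Nat.sSup_mem hne hb
  have har : sInf (levelSet P p l) ≤ sSup (levelSet P p l) :=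
    (Nat.sInf_le (Nat.sSup_mem hne hb))
  rw [window, Nat.card_Icc, Nat.cast_sub (by omega)]
  set a := sInf (levelSet P p l)
  set r := sSup (levelSet P p l)
  have h1 := le_maxCover h0 (l + t) (natCast_mem_Icc hr)
  have h2 := le_maxCover h0 (l - t) (natCast_mem_Icc ha)
  rw [sub_add_cancel]
  have h3 : ((r : ℝ) - a) * t ≤ 2 * gap P p + ((maxCover P (l + t) - maxCover P l) -
        (maxCover P l - maxCover P (l - t))) := by
    nlinarith
  have h4 := (le_div_iff₀ ht).2 h3
  rw [add_div, div_eq_inv_mul (_ - _ : ℝ) t] at h4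
  push_cast
  linarith

theorem logCdf_sub_le {a b : ℝ} (h : a ≤ b) :
    logCdf b - logCdf a ≤ Real.log 2 / 2 * (b - a) :=
  Convex.image_sub_le_mul_sub_of_deriv_le convex_univ
    (fun x _ => (hasDerivAt_logCdf x).continuousAt.continuousWithinAt)
    (fun x _ => (hasDerivAt_logCdf x).differentiableAt.differentiableWithinAt)
    (fun x _ => by rw [(hasDerivAt_logCdf x).deriv]; exact logDensity_le x)
    a (Set.mem_univ _) b (Set.mem_univ _) h

/-- A shift by `t` changes the mean of a function with values in `[0, c]` by at most `c` times
the mass of `[-t / 2, t / 2]`, since the density is even and unimodal. -/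
theorem integral_sub_shift_le {f : ℝ → ℝ} (hf : Continuous f) {c t : ℝ} (h0 : ∀ l, 0 ≤ f l)
    (hc : ∀ l, f l ≤ c) (ht : 0 ≤ t) :
    ∫ l, (f l - f (l - t)) * logDensity l ≤ c * (Real.log 2 / 2 * t) := by
  have hb : ∀ l, ‖f l‖ ≤ c := fun l => by rw [Real.norm_of_nonneg (h0 l)]; exact hc l
  have hw := integrable_logDensity
  have hwt : Integrable fun l => logDensity (l + t) := hw.comp_add_right t
  have i1 : Integrable fun l => f l * logDensity l :=
    hw.bdd_mul (c := c) hf.aestronglyMeasurable (Filter.Eventually.of_forall hb)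
  have i2 : Integrable fun l => f l * logDensity (l + t) :=
    hwt.bdd_mul (c := c) hf.aestronglyMeasurable (Filter.Eventually.of_forall hb)
  have i3 : Integrable fun l => f (l - t) * logDensity l :=
    hw.bdd_mul (c := c) (hf.comp (continuous_id.sub continuous_const)).aestronglyMeasurable
      (Filter.Eventually.of_forall fun l => hb _)
  have e3 : ∫ l, f (l - t) * logDensity l = ∫ l, f l * logDensity (l + t) := by
    have := integral_sub_right_eq_self (μ := volume) (fun l => f l * logDensity (l + t)) t
    simpa using this
  have hcontW : ∀ s : ℝ, ∀ x ∈ Set.Ici (-(t / 2)), HasDerivAt (fun l => logCdf (l + s))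
      (logDensity (x + s)) x := fun s x _ =>
    (hasDerivAt_logCdf (x + s)).comp_add_const x s
  have htend : ∀ s : ℝ, Filter.Tendsto (fun l => logCdf (l + s)) Filter.atTop (nhds 1) :=
    fun s => tendsto_logCdf_atTop.comp (Filter.tendsto_atTop_add_const_right _ s Filter.tendsto_id)
  have I : ∀ s : ℝ, ∫ l in Set.Ioi (-(t / 2)), logDensity (l + s) = 1 - logCdf (-(t / 2) + s) :=
    fun s => integral_Ioi_of_hasDerivAt_of_nonneg' (hcontW s) (fun _ _ => logDensity_nonneg _)
      (htend s)
  calc ∫ l, (f l - f (l - t)) * logDensity l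
      = ∫ l, f l * (logDensity l - logDensity (l + t)) := by
        simp only [sub_mul, mul_sub]
        rw [integral_sub i1 i3, integral_sub i1 i2, e3]
    _ ≤ ∫ l, (Set.Ioi (-(t / 2))).indicator
          (fun l => c * (logDensity l - logDensity (l + t))) l := by
        refine integral_mono (by simp only [mul_sub]; exact i1.sub i2)
          (((hw.sub hwt).const_mul c).indicator measurableSet_Ioi) fun l => ?_
        by_cases hl : l ∈ Set.Ioi (-(t / 2))
        · rw [Set.indicator_of_mem hl]
          have hl' : -(t / 2) < l := hl
          have : |l| ≤ |l + t| := sq_le_sq.1 (by nlinarith)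
          exact mul_le_mul_of_nonneg_right (hc l) (sub_nonneg.2 (logDensity_le_of_abs_le this))
        · rw [Set.indicator_of_notMem hl]
          have hl' : l ≤ -(t / 2) := not_lt.1 hl
          have : |l + t| ≤ |l| := sq_le_sq.1 (by nlinarith)
          exact mul_nonpos_of_nonneg_of_nonpos (h0 l)
            (sub_nonpos.2 (logDensity_le_of_abs_le this))
    _ = c * (logCdf (t / 2) - logCdf (-(t / 2))) := by
        have I0 := I 0
        have It := I t
        simp only [add_zero] at I0
        rw [integral_indicator measurableSet_Ioi, integral_const_mul,
          integral_sub hw.integrableOn hwt.integrableOn, I0, It]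
        ring_nf
    _ ≤ c * (Real.log 2 / 2 * t) := by
        have hc0 : 0 ≤ c := (h0 0).trans (hc 0)
        have := logCdf_sub_le (show -(t / 2) ≤ t / 2 by linarith)
        rw [show t / 2 - -(t / 2) = t by ring] at this
        gcongr

theorem avgWindowCard_le (h0 : P.coeff 0 ≠ 0) (p : ℕ) {t : ℝ} (ht : 0 < t) :
    avgWindowCard P p ≤ 1 + 2 * gap P p / t + P.natDegree * (Real.log 2 / 2 * t) := by
  set f : ℝ → ℝ := fun l => maxCover P (l + t) - maxCover P l with hf
  have hcont := continuous_maxCover h0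
  have hfc : Continuous f := (hcont.comp (continuous_id.add continuous_const)).sub hcont
  have hf0 : ∀ l, 0 ≤ f l := fun l => sub_nonneg.2 (maxCover_le_add h0 l ht.le)
  have hf1 : ∀ l, f l ≤ P.natDegree * t := fun l =>
    sub_le_iff_le_add'.2 (maxCover_add_le h0 l ht.le)
  have hfs : Integrable fun l => (f l - f (l - t)) * logDensity l := by
    refine integrable_logDensity.bdd_mul (c := P.natDegree * t)
      (hfc.sub (hfc.comp (continuous_id.sub continuous_const))).aestronglyMeasurable
      (Filter.Eventually.of_forall fun l => ?_)
    exact abs_le.2 ⟨by linarith [hf0 l, hf1 (l - t)], by linarith [hf1 l, hf0 (l - t)]⟩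
  have key := integral_sub_shift_le hfc hf0 hf1 ht.le
  rw [avgWindowCard_eq]
  calc ∫ l, ((window P p l).card : ℝ) * logDensity l
      ≤ ∫ l, ((1 + 2 * gap P p / t) * logDensity l +
          t⁻¹ * ((f l - f (l - t)) * logDensity l)) := by
        refine integral_mono (integrable_card_window_mul h0 p)
          ((integrable_logDensity.const_mul _).add (hfs.const_mul _)) fun l => ?_
        have := mul_le_mul_of_nonneg_right (card_window_le h0 p l ht) (logDensity_nonneg l)
        rw [add_mul, mul_assoc] at this
        exact this
    _ = 1 + 2 * gap P p / t + t⁻¹ * ∫ l, (f l - f (l - t)) * logDensity l := by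
        rw [integral_add (integrable_logDensity.const_mul _) (hfs.const_mul _),
          integral_const_mul, integral_const_mul, integral_logDensity, mul_one]
    _ ≤ 1 + 2 * gap P p / t + t⁻¹ * (P.natDegree * t * (Real.log 2 / 2 * t)) := by gcongr
    _ = _ := by field_simp

theorem avgWindowCard_lt (h0 : P.coeff 0 ≠ 0) (hd : 1 ≤ P.natDegree) (p : ℕ) :
    avgWindowCard P p < 1 + 1.9046 * √((P.natDegree : ℝ) * gap P p) := by
  have hd' : (1 : ℝ) ≤ P.natDegree := by exact_mod_cast hd
  have hg : 0 < gap P p := by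
    have : (1 : ℝ) ≤ scaleInt (P.natDegree : ℂ) := by exact_mod_cast scaleInt_natCast_pos hd
    unfold gap
    positivity
  have hS : 0 < √((P.natDegree : ℝ) * gap P p) := Real.sqrt_pos.2 (by positivity)
  have hS2 := Real.mul_self_sqrt (show 0 ≤ (P.natDegree : ℝ) * gap P p by positivity)
  set S := √((P.natDegree : ℝ) * gap P p)
  -- this step balances, up to a constant, the two error terms of `avgWindowCard_le`
  have h := avgWindowCard_le h0 p (t := 2 * S / P.natDegree) (by positivity)
  have e1 : 2 * gap P p / (2 * S / P.natDegree) = S := by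
    field_simp
    linarith
  have e2 : (P.natDegree : ℝ) * (Real.log 2 / 2 * (2 * S / P.natDegree)) = Real.log 2 * S := by
    field_simp
  rw [e1, e2] at h
  have := Real.log_two_lt_d9
  nlinarith

end Upper


/-! ### Polynomials with many relevant monomials -/

/-- The depth of the profile of the extremal polynomials at the distance `t` from its middle
`d / 2`. It is quadratic for `|t| ≤ 2 d / 5`, where its slope grows from `0` to `1`, and steeper
quadratic up to `|t| = d / 2`, where its slope reaches `2`. -/
noncomputable def depth (d t : ℝ) : ℝ :=
  (5 / 4 * |t| ^ 2 + 15 / 4 * (max (|t| - 2 * d / 5) 0) ^ 2) / d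

theorem depth_neg (d t : ℝ) : depth d (-t) = depth d t := by simp [depth]

theorem concaveOn_neg_depth {d : ℝ} (hd : 0 < d) (c : ℝ) {s : Set ℝ} (hs : Convex ℝ s) :
    ConcaveOn ℝ s fun x => -depth d (x - c) := by
  have h1 : ConvexOn ℝ s fun x : ℝ => |x - c| := by
    simpa only [Real.dist_eq] using convexOn_dist c hs
  have h2 : ConvexOn ℝ s fun x : ℝ => max (|x - c| - 2 * d / 5) 0 :=
    (h1.add_const (-(2 * d / 5))).sup (convexOn_const 0 hs)
  have h3 : ConvexOn ℝ s fun x : ℝ => |x - c| ^ 2 := h1.pow (fun _ _ => abs_nonneg _) 2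
  have h4 : ConvexOn ℝ s fun x : ℝ => (max (|x - c| - 2 * d / 5) 0) ^ 2 :=
    h2.pow (fun _ _ => le_max_right _ _) 2
  have h5 := ((h3.smul (show (0 : ℝ) ≤ 5 / 4 by norm_num)).add
    (h4.smul (show (0 : ℝ) ≤ 15 / 4 by norm_num))).smul (inv_nonneg.2 hd.le)
  refine (h5.congr fun x _ => ?_).neg
  simp only [depth, Pi.add_apply, smul_eq_mul]
  ring

/-- Near the maximum of `-depth d t + lam * t`, when it is reached in the middle part. -/
theorem neg_depth_le_of_middle {d lam s δ : ℝ} (hd : 0 < d) (hs : |s| ≤ 2 * d / 5)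
    (h : (s - 2 / 5 * d * lam) ^ 2 ≤ 4 * (d * δ / 5)) (t : ℝ) :
    -depth d t + lam * t ≤ -depth d s + lam * s + δ := by
  have e : depth d s = (5 / 4 * |s| ^ 2) / d := by
    rw [depth, max_eq_right (by linarith)]
    ring
  have ht : (5 / 4 * |t| ^ 2) / d ≤ depth d t := by
    unfold depth
    gcongr
    have := sq_nonneg (max (|t| - 2 * d / 5) 0)
    linarith
  rw [sq_abs] at e ht
  have key : (5 / 4 * s ^ 2) / d + lam * t ≤ (5 / 4 * t ^ 2) / d + lam * s + δ := by
    have : (5 / 4 * s ^ 2 + lam * t * d) / d ≤ (5 / 4 * t ^ 2 + (lam * s + δ) * d) / d := by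
      refine div_le_div_of_nonneg_right ?_ hd.le
      nlinarith [sq_nonneg (t - 2 / 5 * d * lam)]
    rw [add_div, add_div, mul_div_cancel_right₀ _ hd.ne', mul_div_cancel_right₀ _ hd.ne'] at this
    linarith
  linarith

/-- Near the maximum of `-depth d t + lam * t`, when it is reached in the right part. -/
theorem neg_depth_le_of_side {d lam s δ : ℝ} (hd : 0 < d) (hlam : 1 ≤ lam) (hs : 2 * d / 5 ≤ s)
    (h : (s - (3 + lam) * d / 10) ^ 2 ≤ d * δ / 5) (t : ℝ) :
    -depth d t + lam * t ≤ -depth d s + lam * s + δ := by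
  have hs0 : |s| = s := abs_of_nonneg (by linarith)
  have e : depth d s = (5 / 4 * s ^ 2 + 15 / 4 * (s - 2 * d / 5) ^ 2) / d := by
    rw [depth, hs0, max_eq_left (by linarith)]
  have hu : t - 2 * d / 5 ≤ max (|t| - 2 * d / 5) 0 :=
    (sub_le_sub_right (le_abs_self t) _).trans (le_max_left _ _)
  have et : depth d t = (5 / 4 * t ^ 2 + 15 / 4 * (max (|t| - 2 * d / 5) 0) ^ 2) / d := by
    rw [depth, sq_abs]
  set u := max (|t| - 2 * d / 5) 0
  have hu0 : 0 ≤ (lam - 1) * d / 10 := by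
    have := mul_nonneg (sub_nonneg.2 hlam) hd.le
    linarith
  have key : (5 / 4 * s ^ 2 + 15 / 4 * (s - 2 * d / 5) ^ 2 + lam * t * d) / d ≤
      (5 / 4 * t ^ 2 + 15 / 4 * u ^ 2 + (lam * s + δ) * d) / d := by
    refine div_le_div_of_nonneg_right ?_ hd.le
    nlinarith [sq_nonneg (t - (3 + lam) * d / 10), sq_nonneg (u - (lam - 1) * d / 10),
      mul_nonneg hu0 (sub_nonneg.2 hu)]
  rw [add_div, add_div _ ((lam * s + δ) * d), mul_div_cancel_right₀ _ hd.ne',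
    mul_div_cancel_right₀ _ hd.ne'] at key
  linarith

/-- The integer height of the `k`-th coefficient of the extremal polynomial of degree `d`. -/
noncomputable def height (d k : ℕ) : ℤ := ⌊-depth d ((k : ℝ) - d / 2)⌋

/-- The polynomials that realise the lower bound: the scale of the `k`-th coefficient is `height d k`. -/
noncomputable def extremalPolynomial (d : ℕ) : ℂ[X] :=
  ∑ k ∈ Finset.range (d + 1), monomial k ((2 : ℂ) ^ (height d k - 1))

theorem coeff_extremalPolynomial {d k : ℕ} (hk : k ≤ d) :
    (extremalPolynomial d).coeff k = (2 : ℂ) ^ (height d k - 1) := by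
  simp [extremalPolynomial, coeff_monomial, hk]

theorem coeff_extremalPolynomial_ne_zero {d k : ℕ} (hk : k ≤ d) :
    (extremalPolynomial d).coeff k ≠ 0 := by
  rw [coeff_extremalPolynomial hk]
  exact zpow_ne_zero _ two_ne_zero

theorem natDegree_extremalPolynomial (d : ℕ) : (extremalPolynomial d).natDegree = d := by
  refine natDegree_eq_of_le_of_coeff_ne_zero ?_ (coeff_extremalPolynomial_ne_zero le_rfl)
  exact natDegree_sum_le_of_forall_le _ _ fun k hk =>
    (natDegree_monomial_le _).trans (Finset.mem_range_succ_iff.1 hk)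

theorem scaleInt_coeff_extremalPolynomial {d k : ℕ} (hk : k ≤ d) :
    scaleInt ((extremalPolynomial d).coeff k) = height d k := by
  rw [coeff_extremalPolynomial hk, scaleInt_two_zpow, sub_add_cancel]

theorem concaveCover_extremalPolynomial_le {d : ℕ} (hd : 1 ≤ d) {x : ℝ}
    (hx : x ∈ Set.Icc 0 (d : ℝ)) :
    concaveCover (extremalPolynomial d) x ≤ -depth d (x - d / 2) := by
  have hd' : (0 : ℝ) < d := by exact_mod_cast hd
  refine concaveCover_le (g := fun x => -depth d (x - d / 2))
    (coeff_extremalPolynomial_ne_zero (Nat.zero_le _))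
    (concaveOn_neg_depth hd' _ (convex_Icc _ _)) (fun k hk => ?_)
    (by rwa [natDegree_extremalPolynomial])
  rw [natDegree_extremalPolynomial] at hk
  rw [scale_of_ne_zero (coeff_extremalPolynomial_ne_zero hk), EReal.coe_le_coe_iff,
    scaleInt_coeff_extremalPolynomial hk]
  exact Int.floor_le _

theorem gap_extremalPolynomial (d p : ℕ) :
    gap (extremalPolynomial d) p = (p : ℝ) + (scaleInt (d : ℂ) : ℝ) + 3 := by
  rw [gap, natDegree_extremalPolynomial]

theorem goodIndices_extremalPolynomial {d : ℕ} (hd : 1 ≤ d) (p : ℕ) :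
    goodIndices (extremalPolynomial d) p = Finset.range (d + 1) := by
  rw [goodIndices, natDegree_extremalPolynomial]
  refine Finset.filter_true_of_mem fun k hk => ?_
  have hk' := Finset.mem_range_succ_iff.1 hk
  rw [scale_of_ne_zero (coeff_extremalPolynomial_ne_zero hk'), EReal.coe_le_coe_iff,
    scaleInt_coeff_extremalPolynomial hk', gap_extremalPolynomial]
  have h1 := concaveCover_extremalPolynomial_le hd (x := k)
    ⟨Nat.cast_nonneg _, Nat.cast_le.2 hk'⟩
  have h2 : -depth d ((k : ℝ) - d / 2) < height d k + 1 := Int.lt_floor_add_one _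
  have h3 : (1 : ℝ) ≤ scaleInt (d : ℂ) := by exact_mod_cast scaleInt_natCast_pos hd
  have h4 : (0 : ℝ) ≤ p := Nat.cast_nonneg _
  linarith

/-- The rounding of the heights to integers costs at most one bit of the gap. -/
theorem mem_levelSet_extremalPolynomial {d : ℕ} (hd : 1 ≤ d) {p k : ℕ} (hk : k ≤ d) {lam : ℝ}
    (h : ∀ t : ℝ, -depth d t + lam * t ≤ -depth d ((k : ℝ) - d / 2) + lam * ((k : ℝ) - d / 2) +
      (gap (extremalPolynomial d) p - 1)) :
    k ∈ levelSet (extremalPolynomial d) p lam := by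
  refine ⟨by rwa [natDegree_extremalPolynomial], ?_⟩
  have h1 := scaleInt_le_concaveCover (P := extremalPolynomial d) (k := k)
    (by rwa [natDegree_extremalPolynomial]) (coeff_extremalPolynomial_ne_zero hk)
  rw [scaleInt_coeff_extremalPolynomial hk] at h1
  have h2 : -depth d ((k : ℝ) - d / 2) < height d k + 1 := Int.lt_floor_add_one _
  rw [sub_le_iff_le_add]
  refine maxCover_le fun x hx => ?_
  rw [natDegree_extremalPolynomial] at hx
  have h3 := concaveCover_extremalPolynomial_le hd hx
  have h4 := h (x - d / 2)
  linarith

theorem le_card_window {P : ℂ[X]} {p : ℕ} {lam a b : ℝ} (ha : 0 ≤ a)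
    (h : ∀ k : ℕ, a ≤ k → (k : ℝ) ≤ b → k ∈ levelSet P p lam) :
    b - a - 1 ≤ ((window P p lam).card : ℝ) := by
  rcases lt_or_ge b 0 with hb | hb
  · have : (0 : ℝ) ≤ (window P p lam).card := Nat.cast_nonneg _
    linarith
  have hsub : Finset.Icc ⌈a⌉₊ ⌊b⌋₊ ⊆ window P p lam := fun k hk => by
    obtain ⟨h1, h2⟩ := Finset.mem_Icc.1 hk
    exact mem_window_of_mem_levelSet (h k (Nat.ceil_le.1 h1) ((Nat.le_floor_iff hb).1 h2))
  have hc := Finset.card_le_card hsub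
  rw [Nat.card_Icc] at hc
  have hc' : ⌊b⌋₊ + 1 ≤ (window P p lam).card + ⌈a⌉₊ := by omega
  have hc'' : (⌊b⌋₊ : ℝ) + 1 ≤ (window P p lam).card + ⌈a⌉₊ := by exact_mod_cast hc'
  have h1 := Nat.ceil_lt_add_one ha
  have h2 := Nat.lt_floor_add_one b
  linarith

theorem sq_le_sq_of_abs_sub_le {x c r : ℝ} (h1 : c - r ≤ x) (h2 : x ≤ c + r) :
    (x - c) ^ 2 ≤ r ^ 2 :=
  sq_le_sq' (by linarith) (by linarith)

section Windows

variable {d p : ℕ} {lam r : ℝ}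

theorem le_card_window_of_middle (hd : 1 ≤ d)
    (hr : r ^ 2 = d * (gap (extremalPolynomial d) p - 1) / 5)
    (h1 : 2 * r ≤ 2 / 5 * d * (1 - |lam|)) :
    4 * r - 1 ≤ ((window (extremalPolynomial d) p lam).card : ℝ) := by
  have hd' : (0 : ℝ) < d := by exact_mod_cast hd
  have hl : |2 / 5 * d * lam| = 2 / 5 * d * |lam| := by
    rw [abs_mul, abs_of_pos (by positivity)]
  obtain ⟨h2, h3⟩ := abs_le.1 hl.le
  have := le_card_window (P := extremalPolynomial d) (p := p) (lam := lam)
    (a := d / 2 + 2 / 5 * d * lam - 2 * r) (b := d / 2 + 2 / 5 * d * lam + 2 * r)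
    (by linarith) fun k hka hkb => ?_
  · linarith
  refine mem_levelSet_extremalPolynomial hd (by exact_mod_cast (by linarith : (k : ℝ) ≤ d))
    (neg_depth_le_of_middle hd' (abs_le.2 ⟨by linarith, by linarith⟩) ?_)
  rw [← hr, show 4 * r ^ 2 = (2 * r) ^ 2 by ring]
  exact sq_le_sq_of_abs_sub_le (by linarith) (by linarith)

theorem le_card_window_of_right (hd : 1 ≤ d)
    (hr : r ^ 2 = d * (gap (extremalPolynomial d) p - 1) / 5) (hr0 : 0 ≤ r)
    (h1 : r ≤ (lam - 1) * d / 10) (h2 : r ≤ (2 - lam) * d / 10) :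
    2 * r - 1 ≤ ((window (extremalPolynomial d) p lam).card : ℝ) := by
  have hd' : (0 : ℝ) < d := by exact_mod_cast hd
  have hl : 1 ≤ lam := by nlinarith
  have := le_card_window (P := extremalPolynomial d) (p := p) (lam := lam)
    (a := d / 2 + (3 + lam) * d / 10 - r) (b := d / 2 + (3 + lam) * d / 10 + r)
    (by linarith) fun k hka hkb => ?_
  · linarith
  refine mem_levelSet_extremalPolynomial hd (by exact_mod_cast (by linarith : (k : ℝ) ≤ d))
    (neg_depth_le_of_side hd' hl (by linarith) ?_)
  rw [← hr]
  exact sq_le_sq_of_abs_sub_le (by linarith) (by linarith)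

theorem le_card_window_of_left (hd : 1 ≤ d)
    (hr : r ^ 2 = d * (gap (extremalPolynomial d) p - 1) / 5) (hr0 : 0 ≤ r)
    (h1 : r ≤ (-lam - 1) * d / 10) (h2 : r ≤ (2 - -lam) * d / 10) :
    2 * r - 1 ≤ ((window (extremalPolynomial d) p lam).card : ℝ) := by
  have hd' : (0 : ℝ) < d := by exact_mod_cast hd
  have hl : 1 ≤ -lam := by nlinarith
  have := le_card_window (P := extremalPolynomial d) (p := p) (lam := lam)
    (a := d / 2 - (3 + -lam) * d / 10 - r) (b := d / 2 - (3 + -lam) * d / 10 + r)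
    (by linarith) fun k hka hkb => ?_
  · linarith
  refine mem_levelSet_extremalPolynomial hd (by exact_mod_cast (by linarith : (k : ℝ) ≤ d))
    fun t => ?_
  have := neg_depth_le_of_side (lam := -lam) (s := -((k : ℝ) - d / 2))
    (δ := gap (extremalPolynomial d) p - 1) hd' hl (by linarith) ?_ (-t)
  · rwa [depth_neg, depth_neg, neg_mul_neg, neg_mul_neg] at this
  rw [← hr]
  exact sq_le_sq_of_abs_sub_le (by linarith) (by linarith)

end Windows

/-! ### The lower bound of the average -/

theorem mul_sub_le_setIntegral {P : ℂ[X]} (h0 : P.coeff 0 ≠ 0) {p : ℕ} {a b c : ℝ} (hab : a ≤ b)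
    (h : ∀ l ∈ Set.Ioc a b, c ≤ ((window P p l).card : ℝ)) :
    c * (logCdf b - logCdf a) ≤
      ∫ l in Set.Ioc a b, ((window P p l).card : ℝ) * logDensity l := by
  rw [← setIntegral_logDensity_Ioc hab, ← integral_const_mul]
  exact setIntegral_mono_on (integrable_logDensity.const_mul c).integrableOn
    (integrable_card_window_mul h0 p).integrableOn measurableSet_Ioc
    fun l hl => mul_le_mul_of_nonneg_right (h l hl) (logDensity_nonneg l)

theorem sum_setIntegral_le_avgWindowCard {P : ℂ[X]} (h0 : P.coeff 0 ≠ 0) (p : ℕ)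
    {a b c d e f : ℝ} (hbc : b ≤ c) (hcd : c ≤ d) (hde : d ≤ e) :
    (∫ l in Set.Ioc a b, ((window P p l).card : ℝ) * logDensity l) +
      (∫ l in Set.Ioc c d, ((window P p l).card : ℝ) * logDensity l) +
      (∫ l in Set.Ioc e f, ((window P p l).card : ℝ) * logDensity l) ≤ avgWindowCard P p := by
  have hi := integrable_card_window_mul h0 p
  have h1 : Disjoint (Set.Ioc a b) (Set.Ioc c d) :=
    Set.disjoint_left.2 fun x hx hx' => absurd hx'.1 (not_lt.2 (hx.2.trans hbc))
  have h2 : Disjoint (Set.Ioc a b ∪ Set.Ioc c d) (Set.Ioc e f) := by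
    refine Set.disjoint_left.2 fun x hx hx' => absurd hx'.1 (not_lt.2 ?_)
    rcases hx with hx | hx
    · exact hx.2.trans (hbc.trans (hcd.trans hde))
    · exact hx.2.trans hde
  rw [avgWindowCard_eq, ← setIntegral_union h1 measurableSet_Ioc hi.integrableOn hi.integrableOn,
    ← setIntegral_union h2 measurableSet_Ioc hi.integrableOn hi.integrableOn]
  exact setIntegral_le_integral hi (Filter.Eventually.of_forall fun l =>
    mul_nonneg (Nat.cast_nonneg _) (logDensity_nonneg l))

theorem logCdf_logb {x : ℝ} (hx : 0 < x) : logCdf (Real.logb 4 x) = 1 - (1 + x)⁻¹ := by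
  rw [logCdf, Real.rpow_logb (by norm_num) (by norm_num) hx]

theorem logCdf_neg_logb {x : ℝ} (hx : 0 < x) : logCdf (-Real.logb 4 x) = 1 - (1 + x⁻¹)⁻¹ := by
  rw [← Real.logb_inv, logCdf_logb (inv_pos.2 hx)]

/-- The slopes `|l| < 1` and `1 < |l| < 2` have the masses `3 / 5` and `24 / 85`. They are cut off
slightly before the ends of these intervals, to keep the windows within one part of the profile. -/
theorem le_avgWindowCard_extremalPolynomial {d p : ℕ} {r : ℝ} (hd : 1 ≤ d)
    (hr : r ^ 2 = d * (gap (extremalPolynomial d) p - 1) / 5) (hr0 : 0 ≤ r)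
    (h1 : 2 * r ≤ 2 / 5 * d * (1 - Real.logb 4 3.999))
    (h2 : r ≤ (Real.logb 4 4.001 - 1) * d / 10) (h3 : r ≤ (2 - Real.logb 4 15.99) * d / 10) :
    2.964 * r - 1 ≤ avgWindowCard (extremalPolynomial d) p := by
  have hd' : (0 : ℝ) < d := by exact_mod_cast hd
  have hc := coeff_extremalPolynomial_ne_zero (d := d) (Nat.zero_le _)
  have hab : Real.logb 4 3.999 ≤ Real.logb 4 4.001 :=
    Real.logb_le_logb_of_le (by norm_num) (by norm_num) (by norm_num)
  have hbc : Real.logb 4 4.001 ≤ Real.logb 4 15.99 :=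
    Real.logb_le_logb_of_le (by norm_num) (by norm_num) (by norm_num)
  have ha0 : 0 ≤ Real.logb 4 3.999 := Real.logb_nonneg (by norm_num) (by norm_num)
  have hm := mul_sub_le_setIntegral hc (p := p) (c := 4 * r - 1)
    (show -Real.logb 4 3.999 ≤ Real.logb 4 3.999 by linarith) fun l hl =>
      le_card_window_of_middle hd hr (h1.trans (by
        have : |l| ≤ Real.logb 4 3.999 := abs_le.2 ⟨hl.1.le, hl.2⟩
        gcongr))
  have hR := mul_sub_le_setIntegral hc (p := p) (c := 2 * r - 1) hbc fun l hl =>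
      le_card_window_of_right hd hr hr0
        (h2.trans (by have := hl.1.le; gcongr)) (h3.trans (by have := hl.2; gcongr))
  have hL := mul_sub_le_setIntegral hc (p := p) (c := 2 * r - 1)
    (neg_le_neg hbc) fun l hl =>
      le_card_window_of_left hd hr hr0
        (h2.trans (by have := le_neg.2 hl.2; gcongr))
        (h3.trans (by have := neg_le.2 hl.1.le; gcongr))
  have hsum := sum_setIntegral_le_avgWindowCard hc p (a := -Real.logb 4 15.99)
    (f := Real.logb 4 15.99) (neg_le_neg hab) (by linarith) hab
  rw [logCdf_logb (by norm_num), logCdf_neg_logb (by norm_num)] at hm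
  rw [logCdf_logb (by norm_num), logCdf_logb (by norm_num)] at hR
  rw [logCdf_neg_logb (by norm_num), logCdf_neg_logb (by norm_num)] at hL
  norm_num at hm hR hL
  linarith

theorem eventually_scaleInt_natCast_le {ε : ℝ} (hε : 0 < ε) :
    ∀ᶠ d : ℕ in Filter.atTop, (scaleInt (d : ℂ) : ℝ) ≤ 1 + ε * d := by
  have h := ((Real.isLittleO_log_id_atTop.comp_tendsto tendsto_natCast_atTop_atTop).def
    (mul_pos hε (Real.log_pos one_lt_two)))
  filter_upwards [h, Filter.eventually_ge_atTop 1] with d hd hd1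
  have hd1' : (1 : ℝ) ≤ d := by exact_mod_cast hd1
  simp only [Function.comp_apply, id, Real.norm_eq_abs, abs_of_nonneg (Real.log_nonneg hd1'),
    Nat.abs_cast] at hd
  have h1 : Real.logb 2 d ≤ ε * d := by
    rw [Real.logb, div_le_iff₀ (Real.log_pos one_lt_two)]
    linarith
  have h2 := Int.floor_le (Real.logb 2 d)
  rw [scaleInt, Complex.norm_natCast]
  push_cast
  linarith

theorem eventually_le_scaleInt_natCast (c : ℝ) :
    ∀ᶠ d : ℕ in Filter.atTop, c ≤ scaleInt (d : ℂ) := by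
  have h := (Real.tendsto_logb_atTop one_lt_two).comp (tendsto_natCast_atTop_atTop (R := ℝ))
  filter_upwards [h.eventually_ge_atTop c] with d hd
  have h2 := Int.lt_floor_add_one (Real.logb 2 d)
  rw [scaleInt, Complex.norm_natCast]
  push_cast
  simp only [Function.comp_apply] at hd
  linarith

theorem eventually_lt_avgWindowCard (p : ℕ) :
    ∀ᶠ d : ℕ in Filter.atTop,
      1.3217 * √((d : ℝ) * ((p : ℝ) + (scaleInt (d : ℂ) : ℝ) + 3)) <
        avgWindowCard (extremalPolynomial d) p := by
  have ha : Real.logb 4 3.999 < 1 := by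
    rw [Real.logb_lt_iff_lt_rpow (by norm_num) (by norm_num)]
    norm_num
  have hb : 1 < Real.logb 4 4.001 := by
    rw [Real.lt_logb_iff_rpow_lt (by norm_num) (by norm_num)]
    norm_num
  have hc : Real.logb 4 15.99 < 2 := by
    rw [Real.logb_lt_iff_lt_rpow (by norm_num) (by norm_num)]
    norm_num
  -- the half-width of the windows is at most `ε d` for large `d`, as the gap is logarithmic
  obtain ⟨ε, hε, hεa, hεb, hεc⟩ : ∃ ε : ℝ, 0 < ε ∧ 5 * ε ≤ 1 - Real.logb 4 3.999 ∧
      10 * ε ≤ Real.logb 4 4.001 - 1 ∧ 10 * ε ≤ 2 - Real.logb 4 15.99 := by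
    refine ⟨min (1 - Real.logb 4 3.999) (min (Real.logb 4 4.001 - 1) (2 - Real.logb 4 15.99)) / 10,
      ?_, ?_, ?_, ?_⟩
    · have := lt_min (sub_pos.2 ha) (lt_min (sub_pos.2 hb) (sub_pos.2 hc))
      linarith
    · have := min_le_left (1 - Real.logb 4 3.999)
        (min (Real.logb 4 4.001 - 1) (2 - Real.logb 4 15.99))
      linarith
    · have := (min_le_right (1 - Real.logb 4 3.999)
        (min (Real.logb 4 4.001 - 1) (2 - Real.logb 4 15.99))).trans (min_le_left _ _)
      linarith
    · have := (min_le_right (1 - Real.logb 4 3.999)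
        (min (Real.logb 4 4.001 - 1) (2 - Real.logb 4 15.99))).trans (min_le_right _ _)
      linarith
  have hlin : ∀ᶠ d : ℕ in Filter.atTop, ((p : ℝ) + 4) / ε ^ 2 ≤ d :=
    tendsto_natCast_atTop_atTop.eventually_ge_atTop _
  filter_upwards [eventually_scaleInt_natCast_le (pow_pos hε 2), hlin,
    eventually_le_scaleInt_natCast 1000, Filter.eventually_ge_atTop 200] with d hs hdp hs' hd200
  have hd1 : 1 ≤ d := by omega
  have hd : (200 : ℝ) ≤ d := by exact_mod_cast hd200
  have hp0 : (0 : ℝ) ≤ p := Nat.cast_nonneg _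
  have hgap := gap_extremalPolynomial d p
  set G := (p : ℝ) + (scaleInt (d : ℂ) : ℝ) + 3 with hG
  have hG1 : 1000 ≤ G := by linarith
  have hGd : G ≤ 2 * (ε ^ 2 * d) := by
    rw [div_le_iff₀ (by positivity)] at hdp
    linarith
  set r := √(d * (G - 1) / 5) with hr
  have hr0 : 0 ≤ r := Real.sqrt_nonneg _
  have hr2 : r ^ 2 = d * (G - 1) / 5 :=
    Real.sq_sqrt (div_nonneg (mul_nonneg (by linarith) (by linarith)) (by norm_num))
  have hrd : r ≤ ε * d := by
    refine Real.sqrt_le_iff.2 ⟨by positivity, ?_⟩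
    nlinarith
  set T := √((d : ℝ) * G) with hT
  have hT0 : 0 ≤ T := Real.sqrt_nonneg _
  have hT2 : T ^ 2 = d * G := Real.sq_sqrt (mul_nonneg (by linarith) (by linarith))
  have hT400 : 400 < T := by
    refine Real.lt_sqrt_of_sq_lt ?_
    nlinarith
  -- as the gap tends to infinity, the bit lost in rounding the heights does not matter
  have hrT : 0.44698 * T ≤ r := by
    refine Real.le_sqrt_of_sq_le ?_
    rw [mul_pow, hT2]
    nlinarith
  have key := le_avgWindowCard_extremalPolynomial (p := p) hd1 (by rw [hgap, hr2]) hr0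
    (by nlinarith) (by nlinarith) (by nlinarith)
  linarith

end FPE

theorem mainTheorem1 :
    (∀ (P : Polynomial ℂ) (p : ℕ), 1 ≤ p → 1 ≤ P.natDegree → P.coeff 0 ≠ 0 →
      (∀ z : ℂ, z ≠ 0 →
        0 ≤ FPE.cancelledBits P z ∧
        FPE.Similar ((p : EReal) - FPE.cancelledBits P z) (P.eval z)
          ((FPE.subexpression P p (Real.logb 2 ‖z‖)).eval z) ∧
        ((∀ k ∈ FPE.keptIndices P p (Real.logb 2 ‖z‖),
            FPE.roundComplex p (P.coeff k) = P.coeff k) →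
          FPE.Similar ((p : EReal) - FPE.cancelledBits P z) (P.eval z)
            ((FPE.roundedSubexpression P p (Real.logb 2 ‖z‖)).eval z)) ∧
        FPE.Similar
          ((p : EReal) - FPE.cancelledBits P z - FPE.scale (P.natDegree : ℂ) - 2) (P.eval z)
          ((FPE.roundedSubexpression P p (Real.logb 2 ‖z‖)).eval z)) ∧
      MeasureTheory.Integrable (FPE.windowCard P p) FPE.sphereMeasure ∧
      FPE.avgWindowCard P p <
        1 + 1.9046 * √((P.natDegree : ℝ) *
          ((p : ℝ) + (FPE.scaleInt (P.natDegree : ℂ) : ℝ) + 3))) ∧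
    (∀ p : ℕ, 1 ≤ p → ∃ P : ℕ → Polynomial ℂ,
      (∀ d : ℕ, 1 ≤ d → (P d).natDegree = d ∧ (P d).coeff 0 ≠ 0 ∧
        FPE.goodIndices (P d) p = Finset.range (d + 1)) ∧
      ∀ᶠ d : ℕ in Filter.atTop,
        1.3217 * √((d : ℝ) * ((p : ℝ) + (FPE.scaleInt (d : ℂ) : ℝ) + 3)) <
          FPE.avgWindowCard (P d) p) := by
  refine ⟨fun P p _ hd h0 => ⟨fun z hz => FPE.correctness h0 hd p hz,
    FPE.integrable_windowCard h0 p, FPE.avgWindowCard_lt h0 hd p⟩, fun p _ =>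
    ⟨FPE.extremalPolynomial, fun d hd => ⟨FPE.natDegree_extremalPolynomial d,
      FPE.coeff_extremalPolynomial_ne_zero (Nat.zero_le _),
      FPE.goodIndices_extremalPolynomial hd p⟩, FPE.eventually_lt_avgWindowCard p⟩⟩
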